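/- Let $\mathfrak o$ be a complete discrete valuation ring with uniformizer $\varpi$ and fraction field $F$, let $\overline F$ be an algebraic closure of $F$, and let $\operatorname{val}:\overline F\to\mathbb Q\cup\{\infty\}$ be the unique valuation with $\operatorname{val}(\varpi)=1$, where $\operatorname{val}(0)=\infty$. In $\mathbb Q\cup\{\infty\}$ the element $\infty$ is the largest, and $x+\infty=\infty+x=\infty$ for all $x$; put $\varpi^\infty=0$. Let $V$ be an $n$-dimensional $F$-vector space, let $T:V\to V$ be any (not necessarily invertible) $F$-linear map, and let $\Lambda\subset V$ be a lattice, i.e. an $\mathfrak o$-submodule that is free of rank $n$. The slopes of $T$ are the valuations of its $n$ eigenvalues in $\overline F$ (roots of the characteristic polynomial, with multiplicity); listed as $\nu_1\le\dots\le\nu_n$ they form the Newton point $\nu(T)=(\nu_1,\dots,\nu_n)$. The Hodge point $\mu(T,\Lambda)=(\mu_1,\dots,\mu_n)$ consists of the elements $\mu_1\le\dots\le\mu_n$ of $\mathbb Z\cup\{\infty\}$ such that $T\Lambda=\mathfrak o\varpi^{\mu_1}e_1+\dots+\mathfrak o\varpi^{\mu_n}e_n$ for some $\mathfrak o$-basis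 $e_1,\dots,e_n$ of $\Lambda$. Then: (1) $\nu(T)\le\mu(T,\Lambda)$ in the dominance order, that is, $\mu_1+\dots+\mu_i\le\nu_1+\dots+\nu_i$ for $i=1,\dots,n-1$, and $\mu_1+\dots+\mu_n=\nu_1+\dots+\nu_n$. (2) Suppose that $V=U\oplus W$ for linear subspaces $U,W$ with $TU\subset U$ and $TW\subset W$, that every slope of $T$ on $U$ is strictly less than every slope of $T$ on $W$, and that $\mu_1+\dots+\mu_r=\nu_1+\dots+\nu_r$, where $r=\dim U$. Then $\Lambda=(\Lambda\cap U)\oplus(\Lambda\cap W)$. -/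

import Mathlib

namespace HodgeNewton

section Valuation

open IsDedekindDomain

variable (O : Type*) [CommRing O] [IsDomain O] [IsDiscreteValuationRing O]
  {F : Type*} [Field F] [Algebra O F] [IsFractionRing O F]
  {Fbar : Type*} [Field Fbar] [Algebra F Fbar]

/-- The normalized additive valuation on the fraction field `F` of the discrete valuation ring `O`,
with value `⊤` at `0` and value `1` at uniformizers. -/
noncomputable def val (x : F) : WithTop ℤ :=
  open Classical in
  if x = 0 then ⊤
  else ((-WithZero.log ((IsDiscreteValuationRing.maximalIdeal O).valuation F x) : ℤ) : WithTop ℤ)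

/-- The underlying function of the extension of `val` to an algebraic extension of `F`: an element
of degree `d` over `F` whose minimal polynomial has constant term `c` (so that its norm from
`F(x)` to `F` is `± c`) has valuation `val c / d`. -/
noncomputable def valBarFun (x : Fbar) : WithTop ℚ :=
  (val O ((minpoly F x).coeff 0)).map fun m : ℤ => (m : ℚ) / ((minpoly F x).natDegree : ℚ)

/-- The real number `2 ^ (-q)`, which is `0` for `q = ⊤`. -/
noncomputable def realExp : WithTop ℚ → ℝ
  | ⊤ => 0
  | (q : ℚ) => (2 : ℝ) ^ (-(q : ℝ))

lemma realExp_coe (q : ℚ) : realExp (q : WithTop ℚ) = (2 : ℝ) ^ (-(q : ℝ)) := rfl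

lemma realExp_strictAnti : StrictAnti realExp := by
  intro a b hab
  induction a using WithTop.recTopCoe with
  | top => exact absurd hab not_top_lt
  | coe a =>
    induction b using WithTop.recTopCoe with
    | top => exact Real.rpow_pos_of_pos two_pos _
    | coe b =>
      rw [realExp_coe, realExp_coe]
      apply Real.rpow_lt_rpow_of_exponent_lt one_lt_two
      have : a < b := WithTop.coe_lt_coe.mp hab
      simpa using this

lemma realExp_add (a b : WithTop ℚ) : realExp (a + b) = realExp a * realExp b := by
  induction a using WithTop.recTopCoe with
  | top => simp [realExp]
  | coe a =>
    induction b using WithTop.recTopCoe with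
    | top => simp [realExp]
    | coe b =>
      rw [← WithTop.coe_add, realExp_coe, realExp_coe, realExp_coe, ← Real.rpow_add two_pos]
      congr 1
      push_cast
      ring

/-- The absolute value `2 ^ (-val x)` on `F`. -/
noncomputable def absVal : AbsoluteValue F ℝ :=
  (IsDiscreteValuationRing.maximalIdeal O).adicAbv (b := 2) one_lt_two

lemma absVal_eq (x : F) (hx : x ≠ 0) : absVal O x =
    (2 : ℝ) ^ (WithZero.log ((IsDiscreteValuationRing.maximalIdeal O).valuation F x)) := by
  have hv : (IsDiscreteValuationRing.maximalIdeal O).valuation F x ≠ 0 := by simpa using hx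
  obtain ⟨m, hm⟩ : ∃ m : ℤ, (IsDiscreteValuationRing.maximalIdeal O).valuation F x
      = WithZero.exp m := ⟨_, (WithZero.exp_log hv).symm⟩
  have h2 : (2 : NNReal) ≠ 0 := two_ne_zero
  change ((WithZeroMulInt.toNNReal h2 _ : NNReal) : ℝ) = _
  rw [hm, WithZero.log_exp, WithZeroMulInt.toNNReal_neg_apply h2 WithZero.exp_ne_zero]
  rfl

lemma absVal_eq_rpow (x : F) (hx : x ≠ 0) : absVal O x =
    (2 : ℝ) ^ (-((-WithZero.log ((IsDiscreteValuationRing.maximalIdeal O).valuation F x) : ℤ)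
      : ℝ)) := by
  rw [absVal_eq O x hx, ← Real.rpow_intCast]
  simp

lemma absVal_le_iff (x : F) (i : ℕ) : absVal O x ≤ (2 : ℝ) ^ (-(i : ℤ)) ↔
    (IsDiscreteValuationRing.maximalIdeal O).valuation F x ≤ WithZero.exp (-(i : ℤ)) := by
  by_cases hx : x = 0
  · simp only [hx, map_zero]
    exact ⟨fun _ => zero_le, fun _ => by positivity⟩
  have hv : (IsDiscreteValuationRing.maximalIdeal O).valuation F x ≠ 0 := by simpa using hx
  rw [absVal_eq O x hx, zpow_le_zpow_iff_right₀ one_lt_two, WithZero.log_le_iff_le_exp hv]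

lemma complete_absVal [IsAdicComplete (IsLocalRing.maximalIdeal O) O] :
    letI : NormedField F := (absVal O).toNormedField
    CompleteSpace F := by
  let _ : NormedField F := (absVal O).toNormedField
  have hnorm : ∀ x : F, ‖x‖ = absVal O x := fun _ => rfl
  refine Metric.complete_of_cauchySeq_tendsto fun u hu => ?_
  have h1 : ∀ i : ℕ, ∃ N, ∀ m, N ≤ m → ∀ n, N ≤ n →
      absVal O (u n - u m) ≤ (2 : ℝ) ^ (-(i : ℤ)) := by
    intro i
    obtain ⟨N, hN⟩ := Metric.cauchySeq_iff.mp hu ((2 : ℝ) ^ (-(i : ℤ))) (by positivity)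
    refine ⟨N, fun m hm n hn => ?_⟩
    have := hN n hn m hm
    rw [dist_eq_norm, hnorm] at this
    exact this.le
  choose N hN using h1
  let M : ℕ → ℕ := fun i => (Finset.Iic i).sup N
  have hNM : ∀ {i j : ℕ}, i ≤ j → N i ≤ M j := fun h => Finset.le_sup (by simpa using h)
  have h2 : ∀ i, ∃ r : O, algebraMap O F r = u (M i) - u (N 0) := by
    intro i
    apply IsDiscreteValuationRing.exists_lift_of_le_one
    have := (absVal_le_iff O _ _).mp (hN 0 (N 0) le_rfl (M i) (hNM (Nat.zero_le _)))
    simpa using this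
  choose r hr using h2
  have hmem : ∀ (a : O) (i : ℕ), a ∈ IsLocalRing.maximalIdeal O ^ i ↔
      absVal O (algebraMap O F a) ≤ (2 : ℝ) ^ (-(i : ℤ)) := by
    intro a i
    rw [absVal_le_iff, HeightOneSpectrum.valuation_of_algebraMap,
      HeightOneSpectrum.intValuation_le_pow_iff_mem]
    rfl
  obtain ⟨L, hL⟩ := IsPrecomplete.prec (I := IsLocalRing.maximalIdeal O) (M := O)
    inferInstance (f := r) (by
      intro m n hmn
      rw [SModEq.sub_mem, smul_eq_mul, Ideal.mul_top, hmem, map_sub, hr, hr, sub_sub_sub_cancel_right]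
      exact hN m _ (hNM hmn) _ (hNM le_rfl))
  refine ⟨u (N 0) + algebraMap O F L, ?_⟩
  rw [Metric.tendsto_atTop]
  intro ε hε
  obtain ⟨i, hi⟩ := exists_pow_lt_of_lt_one hε (show (1 / 2 : ℝ) < 1 by norm_num)
  refine ⟨M i, fun n hn => ?_⟩
  rw [dist_eq_norm, hnorm]
  refine lt_of_le_of_lt ?_ hi
  have e1 : (1 / 2 : ℝ) ^ i = (2 : ℝ) ^ (-(i : ℤ)) := by simp
  have h3 := hL i
  rw [SModEq.sub_mem, smul_eq_mul, Ideal.mul_top, hmem, map_sub, hr] at h3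
  have h4 := hN i (M i) (hNM le_rfl) n ((hNM le_rfl).trans hn)
  have e2 : u n - (u (N 0) + algebraMap O F L) =
      (u n - u (M i)) + (u (M i) - u (N 0) - algebraMap O F L) := by ring
  rw [e1, e2]
  exact (HeightOneSpectrum.isNonarchimedean_adicAbv _ _ _ _).trans (max_le h4 h3)

lemma absVal_eq_realExp (x : F) (d : ℕ) (hd : d ≠ 0) :
    absVal O x ^ (1 / d : ℝ) = realExp ((val O x).map fun m : ℤ => (m : ℚ) / (d : ℚ)) := by
  by_cases hx : x = 0
  · subst hx
    have : (1 / d : ℝ) ≠ 0 := by positivity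
    simp only [val, map_zero, Real.zero_rpow this]
    simp [realExp]
  · simp only [val, if_neg hx, WithTop.map_coe, realExp_coe]
    rw [absVal_eq_rpow O x hx, ← Real.rpow_mul two_pos.le]
    congr 1
    push_cast
    ring

variable (F) in
lemma exists_norm [Algebra.IsAlgebraic F Fbar] [IsAdicComplete (IsLocalRing.maximalIdeal O) O] :
    ∃ g : Fbar → ℝ, (∀ x y, g (x * y) = g x * g y) ∧ (∀ x y, g (x + y) ≤ max (g x) (g y)) ∧
      (∀ x : F, g (algebraMap F Fbar x) = absVal O x) ∧
      ∀ x, g x = realExp (valBarFun O (F := F) x) := by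
  let _ : NormedField F := (absVal O).toNormedField
  have hnorm : ∀ x : F, ‖x‖ = absVal O x := fun _ => rfl
  have : CompleteSpace F := complete_absVal O
  let _ : NontriviallyNormedField F :=
    { (inferInstance : NormedField F) with
      non_trivial := by
        obtain ⟨π, hπ⟩ := (IsDiscreteValuationRing.maximalIdeal O).valuation_exists_uniformizer F
        have h0 : π ≠ 0 := by
          rintro rfl
          rw [map_zero] at hπ
          exact WithZero.exp_ne_zero hπ.symm
        refine ⟨π⁻¹, ?_⟩
        change 1 < absVal O π⁻¹
        rw [map_inv₀, absVal_eq O π h0, hπ]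
        norm_num }
  have : IsUltrametricDist F := IsUltrametricDist.isUltrametricDist_of_isNonarchimedean_norm
    (HeightOneSpectrum.isNonarchimedean_adicAbv _ _)
  refine ⟨spectralNorm F Fbar, fun x y => map_mul (spectralMulAlgNorm F Fbar) x y,
    fun x y => isNonarchimedean_spectralNorm x y, fun x => spectralNorm_extends x, fun x => ?_⟩
  rw [spectralNorm.spectralNorm_eq_norm_coeff_zero_rpow, hnorm, valBarFun, absVal_eq_realExp]
  exact (minpoly.natDegree_pos (Algebra.IsIntegral.isIntegral x)).ne'

lemma valBarFun_algebraMap (x : F) :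
    valBarFun O (F := F) (algebraMap F Fbar x) = (val O x).map ((↑) : ℤ → ℚ) := by
  have h : minpoly F (algebraMap F Fbar x) = Polynomial.X - Polynomial.C x :=
    minpoly.eq_X_sub_C _ x
  have hneg : val O (-x) = val O x := by
    by_cases hx : x = 0
    · rw [hx, neg_zero]
    · simp only [val, if_neg hx, if_neg (neg_ne_zero.mpr hx), Valuation.map_neg]
  simp [valBarFun, h, hneg]

/-- The extension of the valuation of `F` to an algebraic extension `Fbar` of `F` as an additive
valuation with values in `ℚ ∪ {∞}`. -/
noncomputable def valBar (F : Type*) [Field F] [Algebra O F] [IsFractionRing O F]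
    (Fbar : Type*) [Field Fbar] [Algebra F Fbar] [Algebra.IsAlgebraic F Fbar]
    [IsAdicComplete (IsLocalRing.maximalIdeal O) O] : AddValuation Fbar (WithTop ℚ) :=
  AddValuation.of (valBarFun O (F := F))
    (by
      rw [← map_zero (algebraMap F Fbar), valBarFun_algebraMap]
      simp [val])
    (by
      rw [← map_one (algebraMap F Fbar), valBarFun_algebraMap]
      simp [val])
    (by
      intro x y
      obtain ⟨g, -, hadd, -, hg⟩ := exists_norm O F (Fbar := Fbar)
      rcases le_max_iff.mp (hadd x y) with h | h <;> rw [hg, hg, realExp_strictAnti.le_iff_ge] at h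
      · exact min_le_of_left_le h
      · exact min_le_of_right_le h)
    (by
      intro x y
      obtain ⟨g, hmul, -, -, hg⟩ := exists_norm O F (Fbar := Fbar)
      apply realExp_strictAnti.injective
      rw [realExp_add, ← hg, ← hg, ← hg, hmul])

/-- `valBar` extends the normalized valuation of `F`. -/
lemma valBar_algebraMap [Algebra.IsAlgebraic F Fbar] [IsAdicComplete (IsLocalRing.maximalIdeal O) O]
    (x : F) : valBar O F Fbar (algebraMap F Fbar x) = (val O x).map ((↑) : ℤ → ℚ) :=
  valBarFun_algebraMap O x

end Valuation
section Newton

variable (O : Type*) [CommRing O] [IsDomain O] [IsDiscreteValuationRing O]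
  [IsAdicComplete (IsLocalRing.maximalIdeal O) O]
  {F : Type*} [Field F] [Algebra O F] [IsFractionRing O F]
  (Fbar : Type*) [Field Fbar] [Algebra F Fbar] [IsAlgClosure F Fbar]
  {V : Type*} [AddCommGroup V] [Module F V] [FiniteDimensional F V]

/-- The slopes of `T`, with multiplicity: the valuations of its eigenvalues in the algebraic
closure `Fbar`. -/
noncomputable def slopes (T : V →ₗ[F] V) : Multiset (WithTop ℚ) :=
  have : Algebra.IsAlgebraic F Fbar := IsAlgClosure.isAlgebraic
  (T.charpoly.map (algebraMap F Fbar)).roots.map (valBar O F Fbar)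

lemma length_sort_slopes (T : V →ₗ[F] V) :
    ((slopes O Fbar T).sort (· ≤ ·)).length = Module.finrank F V := by
  have : IsAlgClosed Fbar := IsAlgClosure.isAlgClosed F
  rw [Multiset.length_sort, slopes, Multiset.card_map,
    ← (IsAlgClosed.splits (T.charpoly.map (algebraMap F Fbar))).natDegree_eq_card_roots,
    Polynomial.natDegree_map, LinearMap.charpoly_natDegree]

/-- The Newton point of `T`: the slopes of `T` in non-decreasing order. -/
noncomputable def newtonPoint (T : V →ₗ[F] V) : Fin (Module.finrank F V) → WithTop ℚ :=
  fun i => ((slopes O Fbar T).sort (· ≤ ·)).get (i.cast (length_sort_slopes O Fbar T).symm)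

end Newton

section Hodge

variable {O : Type*} [CommRing O] {F : Type*} [Field F] [Algebra O F]

/-- The power `ϖ ^ a` in `F` for `a` in `ℤ ∪ {∞}`, where `ϖ ^ ∞ = 0`. -/
noncomputable def extPow (F : Type*) [Field F] [Algebra O F] (ϖ : O) : WithTop ℤ → F
  | ⊤ => 0
  | (a : ℤ) => algebraMap O F ϖ ^ a

variable {V : Type*} [AddCommGroup V] [Module F V] [Module O V] [IsScalarTower O F V]

/-- `μ` is a Hodge point of `(T, Λ)`: it is non-decreasing and `TΛ` is spanned over `O` by
`ϖ ^ μ₁ • e₁, …, ϖ ^ μₙ • eₙ` for some `O`-basis `e` of `Λ`. -/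
def IsHodgePoint (ϖ : O) (T : V →ₗ[F] V) (Λ : Submodule O V) {n : ℕ}
    (μ : Fin n → WithTop ℤ) : Prop :=
  Monotone μ ∧ ∃ e : Module.Basis (Fin n) O Λ,
    Λ.map (T.restrictScalars O) =
      Submodule.span O (Set.range fun i => extPow F ϖ (μ i) • (e i : V))

lemma exists_isHodgePoint [IsDomain O] [IsDiscreteValuationRing O] [IsFractionRing O F]
    [FiniteDimensional F V] {ϖ : O} (hϖ : Irreducible ϖ) (T : V →ₗ[F] V) (Λ : Submodule O V)
    [Submodule.IsLattice F Λ] :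
    ∃ μ : Fin (Module.finrank F V) → WithTop ℤ, IsHodgePoint ϖ T Λ μ := by
  have hfree : Module.Free O Λ := Submodule.IsLattice.free F Λ
  have hfin : Module.Finite O Λ := Submodule.IsLattice.finite F Λ
  have hrank : Module.finrank O Λ = Module.finrank F V := by
    rw [Module.finrank, Module.finrank, ← Submodule.IsLattice.rank' F Λ]
  let b : Module.Basis (Fin (Module.finrank F V)) O Λ := Module.finBasisOfFinrankEq O Λ hrank
  have hp : algebraMap O F ϖ ≠ 0 := by
    simpa using hϖ.ne_zero
  -- a power of `ϖ` clears the denominators of `T` on `Λ`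
  obtain ⟨k, hk⟩ : ∃ k : ℕ, ∀ x ∈ Λ, ϖ ^ k • T x ∈ Λ := by
    let B : Module.Basis (Fin (Module.finrank F V)) F V := b.extendOfIsLattice F
    have hB : ∀ i, B i = b i := fun i => Module.Basis.extendOfIsLattice_apply F b i
    obtain ⟨c, hc⟩ := IsLocalization.exist_integer_multiples_of_finite (nonZeroDivisors O)
      (fun ij : Fin (Module.finrank F V) × Fin (Module.finrank F V) => B.repr (T (B ij.1)) ij.2)
    obtain ⟨k, u, hu⟩ := IsDiscreteValuationRing.eq_unit_mul_pow_irreducible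
      (nonZeroDivisors.ne_zero c.2) hϖ
    refine ⟨k, fun x hx => ?_⟩
    have hcb : ∀ i, (c : O) • T (B i) ∈ Λ := by
      intro i
      rw [← B.sum_repr (T (B i)), Finset.smul_sum]
      refine Submodule.sum_mem _ fun j _ => ?_
      obtain ⟨r, hr⟩ := hc (i, j)
      rw [← smul_assoc, ← hr, algebraMap_smul, hB]
      exact Λ.smul_mem r (b j).2
    have hcx : (c : O) • T x ∈ Λ := by
      have h : x = ∑ i, b.repr ⟨x, hx⟩ i • B i := by
        have := congrArg Λ.subtype (b.sum_repr ⟨x, hx⟩)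
        rw [map_sum] at this
        simp only [hB]
        exact this.symm
      have hT : T x = ∑ i, b.repr ⟨x, hx⟩ i • T (B i) := by
        conv_lhs => rw [h]
        rw [map_sum]
        exact Finset.sum_congr rfl fun i _ => map_smul (T.restrictScalars O) _ _
      rw [hT, Finset.smul_sum]
      refine Submodule.sum_mem _ fun j _ => ?_
      rw [smul_comm]
      exact Λ.smul_mem _ (hcb j)
    have h3 : ϖ ^ k • T x = (↑u⁻¹ : O) • ((c : O) • T x) := by
      rw [← smul_assoc, hu, smul_eq_mul, Units.inv_mul_cancel_left]
    rw [h3]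
    exact Λ.smul_mem _ hcx
  let N : Submodule O Λ := (Λ.map (ϖ ^ k • T.restrictScalars O)).comap Λ.subtype
  obtain ⟨m, bM, bN, f, a, snf⟩ := Submodule.smithNormalForm b N
  have ha : ∀ i, ∃ (l : ℕ) (u : Oˣ), a i = u * ϖ ^ l := by
    intro i
    refine IsDiscreteValuationRing.eq_unit_mul_pow_irreducible (fun h0 => ?_) hϖ
    have := snf i
    rw [h0, zero_smul] at this
    exact bN.ne_zero i (Subtype.ext this)
  choose l u hlu using ha
  classical
  let μ0 : Fin (Module.finrank F V) → WithTop ℤ := fun j =>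
    if h : ∃ i, f i = j then (((l h.choose : ℤ) - (k : ℤ) : ℤ) : WithTop ℤ) else ⊤
  have hμf : ∀ i, μ0 (f i) = (((l i : ℤ) - (k : ℤ) : ℤ) : WithTop ℤ) := by
    intro i
    have h : ∃ i', f i' = f i := ⟨i, rfl⟩
    have h' : h.choose = i := f.injective h.choose_spec
    simp only [μ0, dif_pos h, h']
  have hgen : ∀ i, ϖ ^ k • (u i : O) • (extPow F ϖ (μ0 (f i)) • (bM (f i) : V)) = (bN i : Λ) := by
    intro i
    have h1 : ((bN i : Λ) : V) = a i • (bM (f i) : V) := congrArg Subtype.val (snf i)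
    rw [h1, hμf, hlu, ← algebraMap_smul F (ϖ ^ k), ← algebraMap_smul F (u i : O),
      ← algebraMap_smul F ((u i : O) * ϖ ^ l i), smul_smul, smul_smul]
    congr 1
    simp only [extPow, map_mul, map_pow, zpow_sub₀ hp, zpow_natCast]
    field_simp
  have hcancel : ∀ x y : V, ϖ ^ k • x = ϖ ^ k • y → x = y := by
    intro x y h
    rw [← algebraMap_smul F (ϖ ^ k), ← algebraMap_smul F (ϖ ^ k) y] at h
    refine smul_right_injective V ?_ h
    rw [map_pow]
    exact pow_ne_zero _ hp
  let σ := Tuple.sort μ0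
  refine ⟨μ0 ∘ σ, Tuple.monotone_sort μ0, bM.reindex σ.symm, ?_⟩
  have hrange : (Set.range fun i => extPow F ϖ ((μ0 ∘ σ) i) • ((bM.reindex σ.symm i : Λ) : V)) =
      Set.range fun j => extPow F ϖ (μ0 j) • (bM j : V) := by
    have : (fun i => extPow F ϖ ((μ0 ∘ σ) i) • ((bM.reindex σ.symm i : Λ) : V)) =
        (fun j => extPow F ϖ (μ0 j) • (bM j : V)) ∘ σ := by
      funext i
      simp
    rw [this, σ.surjective.range_comp]
  rw [hrange]
  apply le_antisymm
  · rintro _ ⟨y, hy, rfl⟩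
    let z : N := ⟨⟨ϖ ^ k • T y, hk y hy⟩, ⟨y, hy, rfl⟩⟩
    have hz : ϖ ^ k • T y = ∑ i, bN.repr z i • ((bN i : Λ) : V) := by
      have := congrArg (Λ.subtype ∘ₗ N.subtype) (bN.sum_repr z)
      rw [map_sum] at this
      exact this.symm
    have hTy : T y = ∑ i, bN.repr z i • (u i : O) •
        (extPow F ϖ (μ0 (f i)) • (bM (f i) : V)) := by
      apply hcancel
      rw [hz, Finset.smul_sum]
      refine Finset.sum_congr rfl fun i _ => ?_
      rw [← hgen i, smul_comm]
    change T y ∈ _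
    rw [hTy]
    refine Submodule.sum_mem _ fun i _ => Submodule.smul_mem _ _ (Submodule.smul_mem _ _ ?_)
    exact Submodule.subset_span ⟨f i, rfl⟩
  · rw [Submodule.span_le]
    rintro _ ⟨j, rfl⟩
    by_cases h : ∃ i, f i = j
    · obtain ⟨i, rfl⟩ := h
      obtain ⟨y, hy, hyi⟩ := (bN i).2
      have h1 : (u i : O) • (extPow F ϖ (μ0 (f i)) • (bM (f i) : V)) = T y := by
        apply hcancel
        rw [hgen i]
        exact hyi.symm
      have h2 : extPow F ϖ (μ0 (f i)) • (bM (f i) : V) = (↑(u i)⁻¹ : O) • T y := by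
        rw [← h1, smul_smul, Units.inv_mul, one_smul]
      change extPow F ϖ (μ0 (f i)) • (bM (f i) : V) ∈ _
      rw [h2]
      exact Submodule.smul_mem _ _ ⟨y, hy, rfl⟩
    · have h0 : μ0 j = ⊤ := dif_neg h
      have h1 : extPow F ϖ (μ0 j) • (bM j : V) = 0 := by
        rw [h0]
        exact zero_smul F _
      change extPow F ϖ (μ0 j) • (bM j : V) ∈ _
      rw [h1]
      exact Submodule.zero_mem _

/-- The Hodge point `μ(T, Λ)`. -/
noncomputable def hodgePoint [IsDomain O] [IsDiscreteValuationRing O] [IsFractionRing O F]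
    [FiniteDimensional F V] {ϖ : O} (hϖ : Irreducible ϖ) (T : V →ₗ[F] V) (Λ : Submodule O V)
    [Submodule.IsLattice F Λ] : Fin (Module.finrank F V) → WithTop ℤ :=
  (exists_isHodgePoint hϖ T Λ).choose

lemma isHodgePoint_hodgePoint [IsDomain O] [IsDiscreteValuationRing O] [IsFractionRing O F]
    [FiniteDimensional F V] {ϖ : O} (hϖ : Irreducible ϖ) (T : V →ₗ[F] V) (Λ : Submodule O V)
    [Submodule.IsLattice F Λ] : IsHodgePoint ϖ T Λ (hodgePoint hϖ T Λ) :=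
  (exists_isHodgePoint hϖ T Λ).choose_spec

end Hodge

section Dominance

/-- The sum of the first `k` entries of an `n`-tuple. -/
def partialSum {n : ℕ} (x : Fin n → WithTop ℚ) (k : ℕ) : WithTop ℚ :=
  ∑ j ∈ Finset.univ.filter (fun j : Fin n => (j : ℕ) < k), x j

/-- The dominance order `ν ≤ μ` on non-decreasing `n`-tuples: the partial sums of `μ` are at most
those of `ν`, and the total sums agree. -/
def DominanceLE {n : ℕ} (ν μ : Fin n → WithTop ℚ) : Prop :=
  (∀ k : ℕ, 1 ≤ k → k < n → partialSum μ k ≤ partialSum ν k) ∧ partialSum μ n = partialSum ν n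

/-- An `n`-tuple with entries in `ℤ ∪ {∞}` regarded as one with entries in `ℚ ∪ {∞}`. -/
def toRat {n : ℕ} (μ : Fin n → WithTop ℤ) : Fin n → WithTop ℚ :=
  fun i => (μ i).map ((↑) : ℤ → ℚ)

end Dominance

end HodgeNewton

/-!
Write `E` for the ambient space, `v` for the valuation, and call a vector integral if it lies in the
lattice. In the basis `e` of the lattice adapted to the Hodge point, the `i`-th row of the matrix of
`T` has valuation at least `μ i`. Expanding an alternating `r`-form in this basis shows that pulling
it back along `T` raises its values on integral vectors by at least `μ 1 + ⋯ + μ r`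
(`le_map_alternating_comp`): the `r`-th exterior power of `T` is divisible by `ϖ ^ (μ 1 + ⋯ + μ r)`.

On a `T`-stable subspace `X` of dimension `r`, pulling back along `T` multiplies every `r`-form by
`det (T | X)`. Since some minor takes the value `1` on integral vectors that form a basis of `X`
(`exists_normalized_basis`), `μ 1 + ⋯ + μ r ≤ v (det (T | X))` (`partialSum_le_map_det_restrict`).
Over the algebraic closure, `X` can be chosen with the `r` smallest slopes
(`exists_stable_of_le_roots`), which gives the dominance inequalities. The total sums agree because
the diagonal matrix of the `ϖ ^ μ i` and the matrix of `T` are integral multiples of each other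
(`valBase_det_le` is the half that is not a special case of the inequality).

For the decomposition, let `r = dim U` and `D = det (T | U)`. The `r` smallest slopes are those on
`U`, so the hypothesis on the partial sums says `v D = μ 1 + ⋯ + μ r`. Then the `r`-th exterior
power of `T` divided by `D` preserves integrality, and so do its powers, which converge to the
exterior power of the projection `p` onto `U` along `W` because the slopes on `U` are smaller than
those on `W`. If `x` is a normalized basis of `U` for the minor `φ`, the `j`-th coordinate of `p z`
is the value of `φ ∘ p` at the tuple `x` with `z` in the `j`-th place, hence integral
(`isIntegralVec_of_add`). The convergence is an estimate on the powers of `T` on `W` and of the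
inverse of `T` on `U`: by the Cayley–Hamilton theorem these satisfy linear recurrences, whose
coefficients are bounded in terms of the slopes (`exists_linear_le_map_pow`,
`exists_linear_le_map_pow_inverse`).
-/

open Module

namespace HodgeNewton

/-! ### Stable subspaces with prescribed eigenvalues -/

section Flags

variable {K : Type*} [Field K]

lemma charpoly_eq_charpoly_restrict_mul_charpoly_mapQ [Infinite K] {E : Type*} [AddCommGroup E]
    [Module K E] [FiniteDimensional K E] (X : Submodule K E) (T : E →ₗ[K] E)
    (hX : ∀ x ∈ X, T x ∈ X) :
    T.charpoly = (T.restrict hX).charpoly * (X.mapQ X T hX).charpoly := by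
  refine Polynomial.funext fun t => ?_
  have h : X ≤ X.comap (algebraMap K (Module.End K E) t - T) := fun x hx =>
    X.sub_mem (X.smul_mem t hx) (hX x hx)
  rw [Polynomial.eval_mul, LinearMap.eval_charpoly, LinearMap.eval_charpoly,
    LinearMap.eval_charpoly, LinearMap.det_eq_det_mul_det X _ h]
  congr 2
  ext x
  rfl

lemma charpoly_eq_of_forall_eq_smul [Infinite K] {E : Type*} [AddCommGroup E] [Module K E]
    [FiniteDimensional K E] (T : E →ₗ[K] E) (a : K) (h : ∀ x, T x = a • x) :
    T.charpoly = (Polynomial.X - Polynomial.C a) ^ finrank K E := by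
  refine Polynomial.funext fun t => ?_
  have h1 : algebraMap K (Module.End K E) t - T = (t - a) • LinearMap.id := by
    ext x
    simp [h, sub_smul]
  rw [LinearMap.eval_charpoly, h1, LinearMap.det_smul]
  simp

/-- Over an algebraically closed field, every sub-multiset of the eigenvalues of `T` is the multiset
of eigenvalues of `T` on some stable subspace. The subspace grows by one dimension at a time, by an
eigenvector of `T` on the quotient by the subspace already found. -/
lemma exists_stable_of_le_roots [IsAlgClosed K] {E : Type*} [AddCommGroup E] [Module K E]
    [FiniteDimensional K E] (T : E →ₗ[K] E) (s : Multiset K) (hs : s ≤ T.charpoly.roots) :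
    ∃ (X : Submodule K E) (hX : ∀ x ∈ X, T x ∈ X),
      (T.restrict hX).charpoly = (s.map fun a => Polynomial.X - Polynomial.C a).prod := by
  have : Infinite K := IsAlgClosed.instInfinite
  induction s using Multiset.induction_on with
  | empty =>
    refine ⟨⊥, fun x hx => by simp_all, ?_⟩
    rw [charpoly_eq_of_forall_eq_smul _ 0 fun x => Subsingleton.elim _ _]
    simp
  | cons a s ih =>
    obtain ⟨X, hX, hc⟩ := ih ((Multiset.le_cons_self s a).trans hs)
    have hmul := charpoly_eq_charpoly_restrict_mul_charpoly_mapQ X T hX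
    have hroots := congrArg Polynomial.roots hmul
    rw [Polynomial.roots_mul (hmul ▸ (LinearMap.charpoly_monic T).ne_zero), hc,
      Polynomial.roots_multiset_prod_X_sub_C] at hroots
    have ha : a ∈ (X.mapQ X T hX).charpoly.roots := by
      rw [hroots, ← Multiset.singleton_add, add_comm] at hs
      exact Multiset.singleton_le.mp (le_of_add_le_add_left hs)
    have ha' := (Module.End.hasEigenvalue_iff_isRoot_charpoly _ _).mpr
      (Polynomial.isRoot_of_mem_roots ha)
    obtain ⟨q, hq⟩ := ha'.exists_hasEigenvector
    obtain ⟨y, rfl⟩ := X.mkQ_surjective q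
    have hyX : y ∉ X := fun h => hq.2 (by simpa using h)
    have hTy : T y - a • y ∈ X := by
      have := hq.apply_eq_smul
      rw [← Submodule.Quotient.mk_eq_zero]
      simpa [sub_eq_zero] using this
    let Y : Submodule K E := X ⊔ K ∙ y
    have hXY : X ≤ Y := le_sup_left
    have hyY : y ∈ Y := Submodule.mem_sup_right (Submodule.mem_span_singleton_self y)
    have hmemY : ∀ z ∈ Y, ∃ x ∈ X, ∃ c : K, x + c • y = z := fun z hz => by
      obtain ⟨x, hx, w, hw, rfl⟩ := Submodule.mem_sup.mp hz
      obtain ⟨c, rfl⟩ := Submodule.mem_span_singleton.mp hw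
      exact ⟨x, hx, c, rfl⟩
    have hTmem : ∀ z ∈ Y, T z - a • z ∈ X := fun z hz => by
      obtain ⟨x, hx, c, rfl⟩ := hmemY z hz
      have : T (x + c • y) - a • (x + c • y) = (T x - a • x) + c • (T y - a • y) := by
        rw [map_add, map_smul]
        module
      rw [this]
      exact X.add_mem (X.sub_mem (hX x hx) (X.smul_mem a hx)) (X.smul_mem c hTy)
    have hY : ∀ z ∈ Y, T z ∈ Y := fun z hz => by
      have := Y.add_mem (hXY (hTmem z hz)) (Y.smul_mem a hz)
      simpa using this
    refine ⟨Y, hY, ?_⟩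
    let N : Submodule K Y := X.comap Y.subtype
    have hN : ∀ z ∈ N, T.restrict hY z ∈ N := fun z hz => hX z hz
    rw [charpoly_eq_charpoly_restrict_mul_charpoly_mapQ N (T.restrict hY) hN]
    have e1 : ((T.restrict hY).restrict hN).charpoly = (T.restrict hX).charpoly := by
      rw [← LinearEquiv.charpoly_conj (Submodule.comapSubtypeEquivOfLe hXY)]
      congr 1
    have e2 : finrank K (Y ⧸ N) = 1 := by
      refine (finrank_eq_one_iff_of_nonzero' (N.mkQ ⟨y, hyY⟩) ?_).mpr fun w => ?_
      · simpa [N] using hyX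
      · obtain ⟨⟨z, hz⟩, rfl⟩ := N.mkQ_surjective w
        obtain ⟨x, hx, c, rfl⟩ := hmemY z hz
        refine ⟨c, ?_⟩
        rw [← map_smul, ← sub_eq_zero, ← map_sub, Submodule.mkQ_apply,
          Submodule.Quotient.mk_eq_zero]
        simpa [N] using hx
    rw [e1, hc, charpoly_eq_of_forall_eq_smul (N.mapQ N (T.restrict hY) hN) a, e2, pow_one,
      Multiset.map_cons, Multiset.prod_cons, mul_comm]
    intro w
    obtain ⟨z, rfl⟩ := N.mkQ_surjective w
    rw [← sub_eq_zero, ← map_smul, Submodule.mkQ_apply, Submodule.mapQ_apply, Submodule.mkQ_apply,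
      ← Submodule.Quotient.mk_sub,
      Submodule.Quotient.mk_eq_zero]
    exact hTmem z z.2

end Flags

/-! ### Alternating forms and minors -/

section Bounds

variable {K : Type*} [Field K] (v : AddValuation K (WithTop ℚ))

lemma map_prod_eq_sum {ι : Type*} (s : Finset ι) (f : ι → K) :
    v (∏ i ∈ s, f i) = ∑ i ∈ s, v (f i) := by
  classical
  induction s using Finset.induction_on with
  | empty => simp
  | insert a s ha ih => rw [Finset.prod_insert ha, Finset.sum_insert ha, v.map_mul, ih]

lemma map_multiset_prod (s : Multiset K) : v s.prod = (s.map v).sum := by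
  induction s using Multiset.induction_on with
  | empty => simp
  | cons a s ih => rw [Multiset.prod_cons, v.map_mul, ih, Multiset.map_cons, Multiset.sum_cons]

lemma partialSum_le_sum_of_injective {n r : ℕ} {μ : Fin n → WithTop ℚ} (hμ : Monotone μ)
    {f : Fin r → Fin n} (hf : Function.Injective f) : partialSum μ r ≤ ∑ j, μ (f j) := by
  classical
  have hrn : r ≤ n := by simpa using Fintype.card_le_of_injective f hf
  have hcard : (Finset.univ.image f).card = r := by
    rw [Finset.card_image_of_injective _ hf, Finset.card_univ, Fintype.card_fin]
  let g := (Finset.univ.image f).orderEmbOfFin hcard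
  have h1 : ∑ j, μ (f j) = ∑ j, μ (g j) := by
    rw [← Finset.sum_image (f := μ) (hf.injOn), ← Finset.sum_image (f := μ) (g.injective.injOn),
      Finset.image_orderEmbOfFin_univ]
  have h2 : partialSum μ r = ∑ j : Fin r, μ (Fin.castLE hrn j) := by
    rw [partialSum, ← Finset.sum_image (f := μ) (Fin.castLE_injective hrn).injOn]
    refine Finset.sum_congr ?_ fun _ _ => rfl
    ext i
    simp only [Finset.mem_filter, Finset.mem_univ, true_and, Finset.mem_image]
    exact ⟨fun h => ⟨⟨i, h⟩, rfl⟩, by rintro ⟨j, rfl⟩; exact j.2⟩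
  rw [h1, h2]
  refine Finset.sum_le_sum fun j _ => hμ ?_
  have h3 : ∀ (i : ℕ) (hi : i < r), i ≤ (g ⟨i, hi⟩ : ℕ) := by
    intro i
    induction i with
    | zero => exact fun _ => Nat.zero_le _
    | succ i ih =>
      intro hi
      have := ih (i.lt_succ_self.trans hi)
      have hlt : g ⟨i, i.lt_succ_self.trans hi⟩ < g ⟨i + 1, hi⟩ :=
        g.strictMono (Fin.mk_lt_mk.mpr i.lt_succ_self)
      have : (g ⟨i, i.lt_succ_self.trans hi⟩ : ℕ) < g ⟨i + 1, hi⟩ := hlt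
      omega
  exact h3 j j.2

variable {E : Type*} [AddCommGroup E] [Module K E] {n : ℕ} (e : Basis (Fin n) K E)

/-- The vector `z` has integral coordinates in the basis `e`. -/
def IsIntegralVec (z : E) : Prop := ∀ i, 0 ≤ v (e.repr z i)

variable {v e}

lemma le_map_repr_of_isIntegralVec {T : E →ₗ[K] E} {μ : Fin n → WithTop ℚ}
    (hT : ∀ i j, μ i ≤ v (e.repr (T (e j)) i)) {z : E} (hz : IsIntegralVec v e z) (i : Fin n) :
    μ i ≤ v (e.repr (T z) i) := by
  have h : e.repr (T z) i = ∑ j, e.repr z j * e.repr (T (e j)) i := by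
    conv_lhs => rw [← e.sum_repr z, map_sum, map_sum, Finsupp.finsetSum_apply]
    simp
  rw [h]
  refine v.map_le_sum fun j _ => ?_
  rw [v.map_mul]
  exact le_add_of_nonneg_of_le (hz j) (hT i j)

/-- The `r`-th exterior power of `T` is divisible by a scalar whose valuation is the sum of the `r`
smallest entries of `μ`; this is phrased through its transpose, which acts on alternating forms. -/
lemma le_map_alternating_comp {T : E →ₗ[K] E} {μ : Fin n → WithTop ℚ} (hμ : Monotone μ)
    (hT : ∀ i j, μ i ≤ v (e.repr (T (e j)) i)) {r : ℕ} (φ : E [⋀^Fin r]→ₗ[K] K) {c : WithTop ℚ}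
    (hφ : ∀ z : Fin r → E, (∀ j, IsIntegralVec v e (z j)) → c ≤ v (φ z))
    (z : Fin r → E) (hz : ∀ j, IsIntegralVec v e (z j)) :
    c + partialSum μ r ≤ v (φ fun j => T (z j)) := by
  classical
  have h : (fun j => T (z j)) = fun j => ∑ i, e.repr (T (z j)) i • e i := by
    funext j
    rw [e.sum_repr]
  rw [h]
  change _ ≤ v (φ.toMultilinearMap _)
  rw [φ.toMultilinearMap.map_sum]
  refine v.map_le_sum fun f _ => ?_
  rw [MultilinearMap.map_smul_univ, smul_eq_mul, v.map_mul, add_comm c, map_prod_eq_sum]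
  by_cases hf : Function.Injective f
  · refine add_le_add ((partialSum_le_sum_of_injective hμ hf).trans
      (Finset.sum_le_sum fun j _ => le_map_repr_of_isIntegralVec hT (hz j) _)) (hφ _ fun j i => ?_)
    rw [e.repr_self, Finsupp.single_apply]
    split_ifs <;> simp
  · have h0 : φ (fun j => e (f j)) = 0 := by
      refine φ.map_eq_zero_of_not_injective _ fun h' => hf fun a b hab => h' ?_
      simp only [hab]
    change _ ≤ _ + v (φ fun j => e (f j))
    rw [h0]
    simp

lemma nsmul_le_map_alternating_comp_pow {T : E →ₗ[K] E} {μ : Fin n → WithTop ℚ} (hμ : Monotone μ)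
    (hT : ∀ i j, μ i ≤ v (e.repr (T (e j)) i)) {r : ℕ} (φ : E [⋀^Fin r]→ₗ[K] K)
    (hφ : ∀ z : Fin r → E, (∀ j, IsIntegralVec v e (z j)) → 0 ≤ v (φ z)) (k : ℕ)
    (z : Fin r → E) (hz : ∀ j, IsIntegralVec v e (z j)) :
    k • partialSum μ r ≤ v (φ fun j => (T ^ k) (z j)) := by
  induction k generalizing z with
  | zero => simpa using hφ z hz
  | succ k ih =>
    rw [succ_nsmul]
    simp only [pow_succ]
    exact le_map_alternating_comp hμ hT (φ.compLinearMap (T ^ k)) ih z hz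

/-- The determinant of the coordinates with indices `I` of `r` vectors, as an alternating form: an
`r × r` minor of the matrix of coordinates. -/
noncomputable def coordDet (e : Basis (Fin n) K E) {r : ℕ} (I : Fin r → Fin n) :
    E [⋀^Fin r]→ₗ[K] K :=
  (Matrix.detRowAlternating (n := Fin r) (R := K)).compLinearMap
    (LinearMap.pi fun i => e.coord (I i))

lemma coordDet_apply {r : ℕ} (I : Fin r → Fin n) (z : Fin r → E) :
    coordDet e I z = Matrix.det (Matrix.of fun j i => e.repr (z j) (I i)) := rfl

lemma coordDet_nonneg {r : ℕ} (I : Fin r → Fin n) (z : Fin r → E)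
    (hz : ∀ j, IsIntegralVec v e (z j)) : 0 ≤ v (coordDet e I z) := by
  rw [coordDet_apply, Matrix.det_apply]
  refine v.map_le_sum fun σ _ => ?_
  have h : ∀ a : K, v (Equiv.Perm.sign σ • a) = v a := fun a => by
    rcases Int.units_eq_one_or (Equiv.Perm.sign σ) with h | h <;> simp [h, v.map_neg]
  rw [h, map_prod_eq_sum]
  exact Finset.sum_nonneg fun i _ => hz _ _

lemma exists_coordDet_ne_zero {r : ℕ} {X : Submodule K E} (x : Basis (Fin r) K X) :
    ∃ I : Fin r → Fin n, coordDet e I (fun j => (x j : E)) ≠ 0 := by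
  let f : Fin n → (Fin r → K) := fun i j => e.repr (x j) i
  have hspan : Submodule.span K (Set.range f) = ⊤ := by
    by_contra hne
    obtain ⟨ℓ, hℓ, hle⟩ := Submodule.exists_le_ker_of_lt_top _ (lt_top_iff_ne_top.mpr hne)
    apply hℓ
    let c : Fin r → K := fun j => ℓ (Pi.single j 1)
    have hℓc : ∀ w : Fin r → K, ℓ w = ∑ j, w j * c j := fun w => by
      conv_lhs => rw [LinearMap.pi_apply_eq_sum_univ ℓ w]
      simp only [smul_eq_mul, c]
      refine Finset.sum_congr rfl fun j _ => ?_
      congr 2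
      ext i
      simp [Pi.single_apply, eq_comm]
    have hsum : ∑ j, c j • (x j : E) = 0 := by
      apply e.ext_elem
      intro i
      have h0 : ℓ (f i) = 0 := hle (Submodule.subset_span ⟨i, rfl⟩)
      rw [hℓc] at h0
      simpa [f, mul_comm] using h0
    have hc : ∀ j, c j = 0 := by
      have hx := x.linearIndependent.map' X.subtype X.ker_subtype
      exact Fintype.linearIndependent_iff.mp hx c hsum
    refine LinearMap.ext fun w => ?_
    simp [hℓc, hc]
  have hrank : finrank K (Submodule.span K (Set.range f)) = r := by
    rw [hspan, finrank_top, finrank_fin_fun]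
  obtain ⟨g, hg, hli⟩ : ∃ g : Fin r → Fin r → K,
      (∀ i, g i ∈ Set.range f) ∧ LinearIndependent K g := by
    obtain ⟨g, hg, -, hli⟩ := Submodule.exists_fun_fin_finrank_span_eq K (Set.range f)
    exact ⟨g ∘ Fin.cast hrank.symm, fun i => hg _, hli.comp _ (Fin.cast_injective _)⟩
  choose I hI using hg
  refine ⟨I, ?_⟩
  have hM : Matrix.of (fun j i => e.repr (x j : E) (I i)) = (Matrix.of g).transpose := by
    ext j i
    simp [← hI, f]
  rw [coordDet_apply, hM, Matrix.det_transpose]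
  exact ((Matrix.isUnit_iff_isUnit_det _).mp
    (Matrix.linearIndependent_rows_iff_isUnit.mp hli)).ne_zero

/-- A subspace has a basis of integral vectors whose coordinates with certain indices `I` form the
identity matrix: take for `I` the indices of a minor of least valuation and apply Cramer's rule. -/
lemma exists_normalized_basis (v : AddValuation K (WithTop ℚ)) (e : Basis (Fin n) K E) {r : ℕ}
    {X : Submodule K E} (x₀ : Basis (Fin r) K X) :
    ∃ (x : Basis (Fin r) K X) (I : Fin r → Fin n),
      (∀ j i, e.repr (x j) (I i) = (1 : Matrix (Fin r) (Fin r) K) j i) ∧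
      ∀ j, IsIntegralVec v e (x j) := by
  classical
  obtain ⟨I₀, hI₀⟩ := exists_coordDet_ne_zero (e := e) x₀
  have : Nonempty (Fin r → Fin n) := ⟨I₀⟩
  obtain ⟨I, hI⟩ := Finite.exists_min fun I : Fin r → Fin n =>
    v (coordDet e I fun j => (x₀ j : E))
  have hne : coordDet e I (fun j => (x₀ j : E)) ≠ 0 := fun h => by
    have := hI I₀
    rw [h, v.map_zero, top_le_iff, v.top_iff] at this
    exact hI₀ this
  let π : X →ₗ[K] (Fin r → K) := LinearMap.pi fun i => e.coord (I i) ∘ₗ X.subtype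
  have hπ : IsUnit (LinearMap.toMatrix x₀ (Pi.basisFun K (Fin r)) π).det := by
    rw [isUnit_iff_ne_zero, ← Matrix.det_transpose]
    convert hne using 2
    rw [coordDet_apply]
    congr 1
    ext i j
    simp [LinearMap.toMatrix_apply, π]
  let x : Basis (Fin r) K X := Basis.ofEquivFun (LinearEquiv.ofIsUnitDet hπ)
  have hx : ∀ j i, e.repr (x j) (I i) = (1 : Matrix (Fin r) (Fin r) K) j i := fun j i => by
    have h : LinearEquiv.ofIsUnitDet hπ (x j) = Pi.single j 1 := by
      rw [Basis.coe_ofEquivFun]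
      exact LinearEquiv.apply_symm_apply _ _
    have h' := congrFun h i
    rw [LinearEquiv.ofIsUnitDet_apply, Pi.single_apply] at h'
    rw [Matrix.one_apply]
    simp only [eq_comm (a := j)]
    exact h'
  refine ⟨x, I, hx, fun j i => ?_⟩
  have hscale : ∀ J : Fin r → Fin n, coordDet e J (fun l => (x₀ l : E)) =
      coordDet e J (fun l => (x l : E)) * x.det x₀ := fun J => by
    have := congrArg (fun ψ => ψ x₀) (((coordDet e J).compLinearMap X.subtype).eq_smul_basis_det x)
    exact this
  have hone : coordDet e I (fun l => (x l : E)) = 1 := by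
    rw [coordDet_apply]
    simp only [hx]
    exact Matrix.det_one
  have hupd : coordDet e (Function.update I j i) (fun l => (x l : E)) = e.repr (x j) i := by
    have hM : Matrix.of (fun l m => e.repr (x l : E) (Function.update I j i m)) =
        (1 : Matrix (Fin r) (Fin r) K).updateCol j fun l => e.repr (x l) i := by
      ext l m
      by_cases hm : m = j
      · subst hm
        simp
      · simp [hm, hx]
    rw [coordDet_apply, hM, ← Matrix.cramer_apply, Matrix.cramer_one]
    rfl
  have h1 := hI (Function.update I j i)
  simp only [hscale] at h1
  rw [hone, hupd, one_mul, v.map_mul] at h1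
  have hd : v (x.det x₀) ≠ ⊤ := by
    rw [v.ne_top_iff]
    intro h
    rw [hscale, h, mul_zero] at hne
    exact hne rfl
  exact (WithTop.add_le_add_iff_right hd).mp ((zero_add _).trans_le h1)

lemma map_apply_eq_det_mul {r : ℕ} (φ : E [⋀^Fin r]→ₗ[K] K) {X : Submodule K E}
    (x : Basis (Fin r) K X) (S : X →ₗ[K] X) (z : Fin r → X) :
    φ (fun j => (S (z j) : E)) = LinearMap.det S * φ fun j => (z j : E) := by
  have h := (φ.compLinearMap X.subtype).eq_smul_basis_det x
  have h1 := congrArg (fun ψ => ψ fun j => S (z j)) h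
  have h2 := congrArg (fun ψ => ψ z) h
  simp only [AlternatingMap.smul_apply, smul_eq_mul] at h1 h2
  have h3 := x.det_comp S z
  rw [Function.comp_def] at h3
  rw [h3] at h1
  change φ (fun j => (S (z j) : E)) = _ at h1
  change φ (fun j => (z j : E)) = _ at h2
  rw [h1, h2]
  ring

/-- The valuation of the determinant of `T` on an `r`-dimensional stable subspace is at least the
sum of the `r` smallest entries of `μ`. -/
lemma partialSum_le_map_det_restrict {T : E →ₗ[K] E} {μ : Fin n → WithTop ℚ} (hμ : Monotone μ)
    (hT : ∀ i j, μ i ≤ v (e.repr (T (e j)) i)) {X : Submodule K E} (hX : ∀ y ∈ X, T y ∈ X) :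
    partialSum μ (finrank K X) ≤ v (LinearMap.det (T.restrict hX)) := by
  have : FiniteDimensional K E := e.finiteDimensional_of_finite
  obtain ⟨x, I, hI, hx⟩ := exists_normalized_basis v e (finBasis K X)
  have h := le_map_alternating_comp hμ hT (coordDet e I) (c := 0) (coordDet_nonneg I)
    (fun j => (x j : E)) hx
  have hdet := map_apply_eq_det_mul (coordDet e I) x (T.restrict hX) x
  simp only [LinearMap.coe_restrict_apply] at hdet
  rw [hdet, coordDet_apply] at h
  simp only [hI] at h
  change _ ≤ v (_ * Matrix.det 1) at h
  simpa using h

end Bounds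

/-! ### Growth of powers of an endomorphism -/

section Growth

variable {K : Type*} [Field K] (v : AddValuation K (WithTop ℚ))

/-- A sequence in a valued field that satisfies a linear recurrence whose coefficients have
valuations on or above a line of slope `-β` has valuations growing at least linearly with
slope `β`. -/
lemma exists_linear_le_of_recurrence (u : ℕ → K) {d : ℕ} (p : ℕ → K) (β : ℚ) (hpd : p d ≠ 0)
    (hp : ∀ i < d, v (p d) + ((((d : ℚ) - i) * β : ℚ) : WithTop ℚ) ≤ v (p i))
    (hrec : ∀ k, ∑ i ∈ Finset.range (d + 1), p i * u (k + i) = 0) :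
    ∃ c : ℚ, ∀ k : ℕ, ((k * β + c : ℚ) : WithTop ℚ) ≤ v (u k) := by
  have hlow : ∀ q : WithTop ℚ, ∃ c : ℚ, (c : WithTop ℚ) ≤ q := fun q => by
    induction q using WithTop.recTopCoe with
    | top => exact ⟨0, le_top⟩
    | coe q => exact ⟨q, le_rfl⟩
  choose low hl using hlow
  -- the least value of `v (u k) - k * β` over the first `d` terms works for all terms
  obtain ⟨c, hc⟩ : ∃ c : ℚ, ∀ k < d, c + k * β ≤ low (v (u k)) := by
    obtain ⟨c, hc⟩ := ((Finset.range d).image fun k : ℕ => low (v (u k)) - k * β).bddBelow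
    refine ⟨c, fun k hk => ?_⟩
    have := hc (Finset.mem_coe.mpr (Finset.mem_image_of_mem _ (Finset.mem_range.mpr hk)))
    linarith
  refine ⟨c, fun k => ?_⟩
  induction k using Nat.strong_induction_on with
  | _ k ih =>
    rcases lt_or_ge k d with hk | hk
    · refine le_trans ?_ (hl _)
      rw [WithTop.coe_le_coe]
      linarith [hc k hk]
    · obtain ⟨m, rfl⟩ := Nat.exists_eq_add_of_le' hk
      have h1 := hrec m
      rw [Finset.sum_range_succ] at h1
      have h2 : v (p d * u (m + d)) = v (∑ i ∈ Finset.range d, p i * u (m + i)) := by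
        rw [eq_neg_of_add_eq_zero_right h1, v.map_neg]
      have h3 : v (p d) + (((m + d : ℕ) * β + c : ℚ) : WithTop ℚ) ≤ v (p d * u (m + d)) := by
        rw [h2]
        refine v.map_le_sum fun i hi => ?_
        rw [Finset.mem_range] at hi
        rw [v.map_mul]
        refine le_trans ?_ (add_le_add (hp i hi) (ih (m + i) (by omega)))
        rw [add_assoc, ← WithTop.coe_add]
        refine add_le_add_right (WithTop.coe_le_coe.mpr (le_of_eq ?_)) _
        push_cast
        ring
      rw [v.map_mul] at h3
      exact (WithTop.add_le_add_iff_left (v.ne_top_iff.mpr hpd)).mp h3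

open Polynomial in
/-- The coefficients of a polynomial with roots of valuation at least `b` lie on or above the line
of slope `-b` through the leading coefficient. -/
lemma le_map_coeff_of_forall_le (s : Multiset K) (b : ℚ) (hs : ∀ a ∈ s, (b : WithTop ℚ) ≤ v a)
    (i : ℕ) : ((((s.card : ℚ) - i) * b : ℚ) : WithTop ℚ) ≤
      v ((s.map fun a => X - C a).prod.coeff i) := by
  induction s using Multiset.induction_on generalizing i with
  | empty =>
    rw [Multiset.map_zero, Multiset.prod_zero, coeff_one]
    split_ifs with h
    · simp [← h]
    · simp
  | cons a s ih =>
    have ih' := ih fun x hx => hs x (Multiset.mem_cons_of_mem hx)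
    rw [Multiset.map_cons, Multiset.prod_cons, sub_mul (X : K[X]), coeff_sub,
      coeff_C_mul]
    refine le_trans (le_min ?_ ?_) (v.map_sub _ _)
    · cases i with
      | zero => simp
      | succ i =>
        rw [coeff_X_mul]
        refine le_trans (WithTop.coe_le_coe.mpr (le_of_eq ?_)) (ih' i)
        rw [Multiset.card_cons]
        push_cast
        ring
    · rw [v.map_mul]
      refine le_trans ?_ (add_le_add (hs a (Multiset.mem_cons_self a s)) (ih' i))
      rw [← WithTop.coe_add]
      refine WithTop.coe_le_coe.mpr (le_of_eq ?_)
      rw [Multiset.card_cons]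
      push_cast
      ring

open Polynomial in
/-- The coefficients of a polynomial with roots of valuation at most `a` lie on or above the line
of slope `-a` through the constant coefficient. -/
lemma map_coeff_zero_le_of_forall_le (s : Multiset K) (a : ℚ)
    (hs : ∀ α ∈ s, v α ≤ (a : WithTop ℚ)) (i : ℕ) :
    v ((s.map fun α => X - C α).prod.coeff 0) ≤
      v ((s.map fun α => X - C α).prod.coeff i) + ((i * a : ℚ) : WithTop ℚ) := by
  induction s using Multiset.induction_on generalizing i with
  | empty =>
    rw [Multiset.map_zero, Multiset.prod_zero]
    rcases eq_or_ne i 0 with rfl | h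
    · simp
    · simp [coeff_one, h]
  | cons α s ih =>
    have ih' := ih fun x hx => hs x (Multiset.mem_cons_of_mem hx)
    rw [Multiset.map_cons, Multiset.prod_cons, sub_mul, coeff_sub, coeff_sub, coeff_C_mul,
      coeff_C_mul, coeff_X_mul_zero, zero_sub, v.map_neg, v.map_mul]
    set P := (s.map fun α => X - C α).prod
    refine le_trans ?_ (add_le_add_left (v.map_sub _ _) _)
    rw [min_add]
    refine le_min ?_ ?_
    · cases i with
      | zero => simp
      | succ i =>
        rw [coeff_X_mul]
        refine le_trans (add_le_add (hs α (Multiset.mem_cons_self α s)) (ih' i)) ?_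
        rw [add_comm, add_assoc, ← WithTop.coe_add]
        refine add_le_add_right (WithTop.coe_le_coe.mpr (le_of_eq ?_)) _
        push_cast
        ring
    · rw [v.map_mul, add_assoc]
      exact add_le_add_right (ih' i) _

open Polynomial in
lemma sum_coeff_charpoly_smul_pow_eq_zero {Y : Type*} [AddCommGroup Y] [Module K Y]
    [FiniteDimensional K Y] (S : Y →ₗ[K] Y) :
    ∑ i ∈ Finset.range (S.charpoly.natDegree + 1), S.charpoly.coeff i • S ^ i = 0 := by
  rw [← aeval_eq_sum_range, LinearMap.aeval_self_charpoly]

variable {L : Type*} [Field L] [IsAlgClosed L] [Algebra K L] (w : AddValuation L (WithTop ℚ))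
  {Y : Type*} [AddCommGroup Y] [Module K Y] [FiniteDimensional K Y]

open Polynomial in
lemma map_charpoly_eq_prod (S : Y →ₗ[K] Y) : S.charpoly.map (algebraMap K L) =
    ((S.charpoly.map (algebraMap K L)).roots.map fun a => X - C a).prod :=
  (IsAlgClosed.splits _).eq_prod_roots_of_monic ((LinearMap.charpoly_monic S).map _)

lemma card_roots_map_charpoly (S : Y →ₗ[K] Y) :
    (S.charpoly.map (algebraMap K L)).roots.card = S.charpoly.natDegree := by
  rw [← (IsAlgClosed.splits _).natDegree_eq_card_roots, Polynomial.natDegree_map]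

/-- If all slopes of `S` are at least `b`, then the valuations of the powers of `S` grow at least
linearly with slope `b`: by the Cayley–Hamilton theorem the powers satisfy a linear recurrence. -/
lemma exists_linear_le_map_pow (S : Y →ₗ[K] Y) (b : ℚ)
    (hS : ∀ a ∈ (S.charpoly.map (algebraMap K L)).roots, (b : WithTop ℚ) ≤ w a)
    (ℓ : Y →ₗ[K] K) (y : Y) : ∃ c : ℚ, ∀ k : ℕ,
      ((k * b + c : ℚ) : WithTop ℚ) ≤ w.comap (algebraMap K L) (ℓ ((S ^ k) y)) := by
  have hlead : S.charpoly.coeff S.charpoly.natDegree = 1 := S.charpoly_monic.coeff_natDegree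
  refine exists_linear_le_of_recurrence _ _ (d := S.charpoly.natDegree) S.charpoly.coeff b
    (by simp [hlead]) (fun i _ => ?_) fun k => ?_
  · rw [hlead, AddValuation.map_one, zero_add]
    have := le_map_coeff_of_forall_le w _ b hS i
    rw [← map_charpoly_eq_prod, card_roots_map_charpoly, Polynomial.coeff_map] at this
    exact this
  · have := congrArg (fun f : Y →ₗ[K] Y => ℓ (f ((S ^ k) y)))
      (sum_coeff_charpoly_smul_pow_eq_zero S)
    simpa [LinearMap.sum_apply, add_comm k, pow_add] using this

/-- If all slopes of `S` are at most `a`, then the valuations of the powers of the inverse `R` of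
`S` grow at least linearly with slope `-a`: the recurrence given by the Cayley–Hamilton theorem is
read backwards. -/
lemma exists_linear_le_map_pow_inverse {S R : Y →ₗ[K] Y} (hSR : S * R = 1) (hRS : R * S = 1) (a : ℚ)
    (hS : ∀ α ∈ (S.charpoly.map (algebraMap K L)).roots, w α ≤ (a : WithTop ℚ))
    (ℓ : Y →ₗ[K] K) (y : Y) : ∃ c : ℚ, ∀ k : ℕ,
      ((k * -a + c : ℚ) : WithTop ℚ) ≤ w.comap (algebraMap K L) (ℓ ((R ^ k) y)) := by
  have hcomm : Commute S R := hSR.trans hRS.symm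
  set d := S.charpoly.natDegree
  have hle : ∀ i, w.comap (algebraMap K L) (S.charpoly.coeff 0) ≤
      w.comap (algebraMap K L) (S.charpoly.coeff i) + ((i * a : ℚ) : WithTop ℚ) := fun i => by
    have := map_coeff_zero_le_of_forall_le w _ a hS i
    rw [← map_charpoly_eq_prod, Polynomial.coeff_map, Polynomial.coeff_map] at this
    exact this
  have h0 : S.charpoly.coeff 0 ≠ 0 := fun h => by
    have h1 := hle d
    rw [S.charpoly_monic.coeff_natDegree, h, AddValuation.map_zero, AddValuation.map_one, zero_add,
      top_le_iff] at h1
    exact WithTop.coe_ne_top h1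
  refine exists_linear_le_of_recurrence _ _ (d := d) (fun i => S.charpoly.coeff (d - i)) (-a)
    (by simpa using h0) (fun i hi => ?_) fun k => ?_
  · simp only [Nat.sub_self]
    refine le_trans (add_le_add_left (hle (d - i)) _) ?_
    rw [add_assoc, ← WithTop.coe_add, Nat.cast_sub hi.le]
    ring_nf
    simp
  · have hterm : ∀ j ∈ Finset.range (d + 1), R ^ (k + (d - j)) = S ^ j * R ^ (k + d) := by
      intro j hj
      have hj' : j ≤ d := by simpa [Nat.lt_succ_iff] using hj
      have h1 : k + d = j + (k + (d - j)) := by omega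
      rw [h1, pow_add R j, ← mul_assoc, ← hcomm.mul_pow, hSR, one_pow, one_mul]
    rw [← Finset.sum_flip]
    have := congrArg (fun f : Y →ₗ[K] Y => ℓ (f ((R ^ (k + d)) y)))
      (sum_coeff_charpoly_smul_pow_eq_zero S)
    simp only [LinearMap.sum_apply, map_sum, LinearMap.smul_apply, map_smul, smul_eq_mul,
      LinearMap.zero_apply, map_zero] at this
    rw [← this]
    refine Finset.sum_congr rfl fun j hj => ?_
    have hj' : j ≤ d := by simpa [Nat.lt_succ_iff] using hj
    rw [hterm j hj, Nat.sub_sub_self hj', Module.End.mul_apply]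

end Growth

/-! ### Integrality of the projection onto the part of smaller slopes -/

section Projection

variable {K : Type*} [Field K] {v : AddValuation K (WithTop ℚ)}
  {E : Type*} [AddCommGroup E] [Module K E] {n : ℕ} {e : Basis (Fin n) K E}

lemma IsIntegralVec.sum_smul {ι : Type*} (s : Finset ι) (c : ι → K) (x : ι → E)
    (hc : ∀ i ∈ s, 0 ≤ v (c i)) (hx : ∀ i ∈ s, IsIntegralVec v e (x i)) :
    IsIntegralVec v e (∑ i ∈ s, c i • x i) := fun j => by
  rw [map_sum, Finsupp.finsetSum_apply]
  refine v.map_le_sum fun i hi => ?_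
  rw [map_smul, Finsupp.smul_apply, smul_eq_mul, v.map_mul]
  exact add_nonneg (hc i hi) (hx i hi j)

lemma coordDet_eq_of_repr_eq {r : ℕ} {I : Fin r → Fin n} {z z' : Fin r → E}
    (h : ∀ j i, e.repr (z j) (I i) = e.repr (z' j) (I i)) : coordDet e I z = coordDet e I z' := by
  rw [coordDet_apply, coordDet_apply]
  simp only [h]

/-- The projection onto `U` along `W` preserves integral vectors. The exterior power of `T`, divided
by the determinant of `T` on `U`, preserves integrality; its powers converge to the exterior power
of the projection. Each coordinate of the projection of a vector is a value of a form that factors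
through that exterior power. -/
theorem isIntegralVec_of_add {T : E →ₗ[K] E} {μ : Fin n → WithTop ℚ} (hμ : Monotone μ)
    (hT : ∀ i j, μ i ≤ v (e.repr (T (e j)) i)) {U W : Submodule K E} (hU : ∀ x ∈ U, T x ∈ U)
    (hW : ∀ x ∈ W, T x ∈ W)
    (hm : v (LinearMap.det (T.restrict hU)) ≤ partialSum μ (finrank K U))
    {R : U →ₗ[K] U} (hTR : T.restrict hU * R = 1) {a b : ℚ} (hab : a < b)
    (hgU : ∀ (ℓ : U →ₗ[K] K) (y : U), ∃ c : ℚ, ∀ k : ℕ,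
      ((k * -a + c : ℚ) : WithTop ℚ) ≤ v (ℓ ((R ^ k) y)))
    (hgW : ∀ (ℓ : W →ₗ[K] K) (y : W), ∃ c : ℚ, ∀ k : ℕ,
      ((k * b + c : ℚ) : WithTop ℚ) ≤ v (ℓ ((T.restrict hW ^ k) y)))
    (u : U) (y : W) (huy : IsIntegralVec v e (u + y)) : IsIntegralVec v e u := by
  have : FiniteDimensional K E := e.finiteDimensional_of_finite
  set r := finrank K U
  obtain ⟨x, I, hI, hx⟩ := exists_normalized_basis v e (finBasis K U)
  set S := T.restrict hU
  set D := LinearMap.det S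
  have hcommTR : ∀ k, S ^ k * R ^ k = 1 := fun k => by
    have hcomm : Commute S R := hTR.trans (mul_eq_one_comm.mp hTR).symm
    rw [← hcomm.mul_pow, hTR, one_pow]
  have hD : v D ≠ ⊤ := by
    have h := congrArg LinearMap.det hTR
    rw [LinearMap.det.map_mul, LinearMap.det.map_one] at h
    exact v.ne_top_iff.mpr (left_ne_zero_of_mul_eq_one h)
  have hpow : ∀ k (g : U), (((S ^ k) g : U) : E) = (T ^ k) g := fun k g => by
    rw [Module.End.pow_restrict]
    rfl
  have hpowW : ∀ k (g : W), (((T.restrict hW ^ k) g : W) : E) = (T ^ k) g := fun k g => by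
    rw [Module.End.pow_restrict]
    rfl
  -- on tuples of vectors of `U`, the form `coordDet e I` is the determinant in the basis `x`
  have hdet : ∀ (j : Fin r) (g : U) (k : ℕ), coordDet e I
      (Function.update (fun l => (T ^ k) (x l)) j ((T ^ k) g)) = D ^ k * x.repr g j := by
    intro j g k
    have h1 : Function.update (fun l => (T ^ k) (x l : E)) j ((T ^ k) (g : E)) =
        fun l => (((S ^ k) (Function.update x j g l) : U) : E) := by
      funext l
      rw [hpow]
      by_cases hl : l = j
      · subst hl
        simp
      · simp [hl]
    rw [h1, map_apply_eq_det_mul _ x, map_pow, coordDet_apply]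
    congr 1
    have hM : Matrix.of (fun l i => e.repr (Function.update x j g l : E) (I i)) =
        (1 : Matrix (Fin r) (Fin r) K).updateRow j (x.repr g) := by
      ext l i
      by_cases hl : l = j
      · subst hl
        have hg : e.repr (g : E) (I i) = ∑ m, x.repr g m * e.repr (x m) (I i) := by
          conv_lhs => rw [← x.sum_repr g, Submodule.coe_sum, map_sum, Finsupp.finsetSum_apply]
          simp
        simp [hg, hI, Matrix.one_apply]
      · simp [hl, hI]
    rw [hM, ← Matrix.cramer_transpose_apply, Matrix.transpose_one, Matrix.cramer_one]
    rfl
  have hq : ∀ j, 0 ≤ v (x.repr u j) := by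
    intro j
    -- `x.repr u j` is the value at `u + y`, in the `j`-th place among the vectors of `x`, of the
    -- pullback of `coordDet e I` under the projection; `ε k` is the error when this pullback is
    -- replaced by that under `T ^ k`, divided by `D ^ k`, and
    -- `s k` is the vector of `U` with the same `I`-coordinates as `T ^ k y`
    let s : ℕ → U := fun k => ∑ i, e.repr ((T ^ k) (y : E)) (I i) • x i
    let ε : ℕ → K := fun k => x.repr ((R ^ k) (s k)) j
    have hs : ∀ k i, e.repr (s k : E) (I i) = e.repr ((T ^ k) (y : E)) (I i) := by
      intro k i
      simp only [s, Submodule.coe_sum, Submodule.coe_smul, map_sum, map_smul,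
        Finsupp.finsetSum_apply, Finsupp.smul_apply, hI, smul_eq_mul]
      simp [Matrix.one_apply]
    have hsum : ∀ k, coordDet e I (fun l => (T ^ k) (Function.update (fun l => (x l : E)) j
        (u + y) l)) = D ^ k * (x.repr u j + ε k) := by
      intro k
      have h1 : (fun l => (T ^ k) (Function.update (fun l => (x l : E)) j (u + y) l)) =
          Function.update (fun l => (T ^ k) (x l : E)) j ((T ^ k) u + (T ^ k) y) := by
        funext l
        by_cases hl : l = j
        · subst hl
          simp
        · simp [hl]
      have h2 : coordDet e I (Function.update (fun l => (T ^ k) (x l : E)) j ((T ^ k) y)) =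
          coordDet e I (Function.update (fun l => (T ^ k) (x l : E)) j
            ((T ^ k) ((R ^ k) (s k) : U))) := by
        refine coordDet_eq_of_repr_eq fun l i => ?_
        by_cases hl : l = j
        · subst hl
          rw [Function.update_self, Function.update_self, ← hpow, ← Module.End.mul_apply,
            hcommTR, Module.End.one_apply, hs]
        · simp [hl]
      rw [h1, AlternatingMap.map_update_add, h2, hdet, hdet, mul_add]
    have hint : ∀ k, 0 ≤ v (x.repr u j + ε k) := by
      intro k
      have h1 := nsmul_le_map_alternating_comp_pow hμ hT (coordDet e I) (coordDet_nonneg I) k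
        (Function.update (fun l => (x l : E)) j (u + y)) (fun l => by
          by_cases hl : l = j
          · subst hl
            simpa using huy
          · simpa [hl] using hx l)
      rw [hsum, v.map_mul, v.map_pow] at h1
      have h2 := (nsmul_le_nsmul_right hm k).trans h1
      have h3 : k • v D ≠ ⊤ := by
        rw [← v.map_pow, v.ne_top_iff]
        exact pow_ne_zero _ (v.ne_top_iff.mp hD)
      exact (WithTop.add_le_add_iff_left h3).mp ((add_zero _).trans_le h2)
    obtain ⟨c, hc⟩ : ∃ c : ℚ, ∀ k : ℕ, ((k * (b - a) + c : ℚ) : WithTop ℚ) ≤ v (ε k) := by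
      choose c₁ hc₁ using fun i => hgU (x.coord j) (x i)
      choose c₂ hc₂ using fun i => hgW (e.coord (I i) ∘ₗ W.subtype) y
      obtain ⟨c, hc⟩ := (Set.finite_range fun i => c₁ i + c₂ i).bddBelow
      refine ⟨c, fun k => ?_⟩
      simp only [ε, s, map_sum, map_smul, Finsupp.finsetSum_apply, Finsupp.smul_apply]
      refine v.map_le_sum fun i _ => ?_
      have h1 := hc₁ i k
      have h2 := hc₂ i k
      rw [LinearMap.comp_apply, Submodule.subtype_apply, hpowW] at h2
      rw [smul_eq_mul, v.map_mul]
      refine le_trans ?_ (add_le_add h2 h1)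
      rw [← WithTop.coe_add, WithTop.coe_le_coe]
      linarith [hc ⟨i, rfl⟩]
    obtain ⟨k, hk⟩ := exists_nat_gt (-c / (b - a))
    have hεk : 0 ≤ v (ε k) := by
      refine le_trans ?_ (hc k)
      rw [← WithTop.coe_zero, WithTop.coe_le_coe]
      rw [div_lt_iff₀ (sub_pos.mpr hab)] at hk
      linarith
    have := v.map_sub (x.repr u j + ε k) (ε k)
    rw [add_sub_cancel_right] at this
    exact (le_min (hint k) hεk).trans this
  have hu : (u : E) = ∑ j, x.repr u j • (x j : E) := by
    conv_lhs => rw [← x.sum_repr u, Submodule.coe_sum]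
    rfl
  rw [hu]
  exact IsIntegralVec.sum_smul _ _ _ (fun j _ => hq j) fun j _ => hx j

end Projection

/-! ### Slopes and the Newton point -/

section Slopes

lemma exists_coe_lt_of_forall_lt {s t : Multiset (WithTop ℚ)} (hs : ∀ x ∈ s, x ≠ ⊤)
    (h : ∀ x ∈ s, ∀ y ∈ t, x < y) : ∃ a b : ℚ, a < b ∧ (∀ x ∈ s, x ≤ (a : WithTop ℚ)) ∧
      ∀ y ∈ t, (b : WithTop ℚ) ≤ y := by
  obtain ⟨a, ha, hat⟩ : ∃ a : ℚ, (∀ x ∈ s, x ≤ (a : WithTop ℚ)) ∧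
      ∀ y ∈ t, (a : WithTop ℚ) < y := by
    induction s using Multiset.induction_on with
    | empty =>
      clear hs h
      induction t using Multiset.induction_on with
      | empty => exact ⟨0, by simp, by simp⟩
      | cons y t ih =>
        obtain ⟨a, -, ha⟩ := ih
        obtain ⟨c, hc⟩ : ∃ c : ℚ, (c : WithTop ℚ) < y := by
          induction y using WithTop.recTopCoe with
          | top => exact ⟨0, WithTop.coe_lt_top _⟩
          | coe y => exact ⟨y - 1, WithTop.coe_lt_coe.mpr (by linarith)⟩
        refine ⟨min a c, by simp, fun z hz => ?_⟩
        rcases Multiset.mem_cons.mp hz with rfl | hz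
        · exact (WithTop.coe_le_coe.mpr (min_le_right a c)).trans_lt hc
        · exact (WithTop.coe_le_coe.mpr (min_le_left a c)).trans_lt (ha z hz)
    | cons x s ih =>
      obtain ⟨a, ha, hat⟩ := ih (fun z hz => hs z (Multiset.mem_cons_of_mem hz))
        fun z hz => h z (Multiset.mem_cons_of_mem hz)
      obtain ⟨c, hc⟩ := WithTop.ne_top_iff_exists.mp (hs x (Multiset.mem_cons_self x s))
      refine ⟨max a c, fun z hz => ?_, fun y hy => ?_⟩
      · rcases Multiset.mem_cons.mp hz with rfl | hz
        · rw [← hc]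
          exact WithTop.coe_le_coe.mpr (le_max_right a c)
        · exact (ha z hz).trans (WithTop.coe_le_coe.mpr (le_max_left a c))
      · rw [WithTop.coe_max]
        refine max_lt (hat y hy) ?_
        rw [hc]
        exact h x (Multiset.mem_cons_self x s) y hy
  obtain ⟨b, hab, hb⟩ : ∃ b : ℚ, a < b ∧ ∀ y ∈ t, (b : WithTop ℚ) ≤ y := by
    clear h
    induction t using Multiset.induction_on with
    | empty => exact ⟨a + 1, by linarith, by simp⟩
    | cons y t ih =>
      obtain ⟨b, hab, hb⟩ := ih fun z hz => hat z (Multiset.mem_cons_of_mem hz)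
      obtain ⟨c, hac, hc⟩ : ∃ c : ℚ, a < c ∧ (c : WithTop ℚ) ≤ y := by
        have hay := hat y (Multiset.mem_cons_self y t)
        induction y using WithTop.recTopCoe with
        | top => exact ⟨a + 1, by linarith, le_top⟩
        | coe y => exact ⟨y, WithTop.coe_lt_coe.mp hay, le_rfl⟩
      refine ⟨min b c, lt_min hab hac, fun z hz => ?_⟩
      rcases Multiset.mem_cons.mp hz with rfl | hz
      · exact (WithTop.coe_le_coe.mpr (min_le_right b c)).trans hc
      · exact (WithTop.coe_le_coe.mpr (min_le_left b c)).trans (hb z hz)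
  exact ⟨a, b, hab, ha, hb⟩

lemma exists_le_map_eq {α β : Type*} (f : α → β) {s : Multiset α} {t : Multiset β}
    (h : t ≤ s.map f) : ∃ u ≤ s, u.map f = t := by
  induction s using Quotient.inductionOn with
  | _ l =>
    induction t using Quotient.inductionOn with
    | _ m =>
      obtain ⟨m', hm', hsub⟩ : m.Subperm (l.map f) := h
      obtain ⟨l', hl', rfl⟩ := List.sublist_map_iff.mp hsub
      exact ⟨l', hl'.subperm, Quotient.sound hm'⟩

lemma sort_add_of_forall_lt {α : Type*} [LinearOrder α] {s t : Multiset α}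
    (h : ∀ x ∈ s, ∀ y ∈ t, x < y) :
    (s + t).sort (· ≤ ·) = s.sort (· ≤ ·) ++ t.sort (· ≤ ·) := by
  refine List.Perm.eq_of_pairwise' (r := (· ≤ ·)) (Multiset.pairwise_sort _ _) ?_ ?_
  · rw [List.pairwise_append]
    exact ⟨Multiset.pairwise_sort _ _, Multiset.pairwise_sort _ _, fun x hx y hy =>
      (h x (by simpa using hx) y (by simpa using hy)).le⟩
  · rw [← Multiset.coe_eq_coe, ← Multiset.coe_add]
    simp

variable (O : Type*) [CommRing O] [IsDomain O] [IsDiscreteValuationRing O]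
  [IsAdicComplete (IsLocalRing.maximalIdeal O) O]
  {F : Type*} [Field F] [Algebra O F] [IsFractionRing O F]
  (Fbar : Type*) [Field Fbar] [Algebra F Fbar] [IsAlgClosure F Fbar]
  {V : Type*} [AddCommGroup V] [Module F V] [FiniteDimensional F V]

variable (F) in
/-- The valuation of the algebraic closure of `F`. -/
noncomputable def valAlgClosure : AddValuation Fbar (WithTop ℚ) :=
  have : Algebra.IsAlgebraic F Fbar := IsAlgClosure.isAlgebraic
  valBar O F Fbar

variable (F) in
/-- The valuation of `F`, as an additive valuation with values in `ℚ ∪ {∞}`. -/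
noncomputable def valBase : AddValuation F (WithTop ℚ) :=
  (valAlgClosure O F Fbar).comap (algebraMap F Fbar)

lemma valBase_apply (x : F) : valBase O F Fbar x = (val O x).map ((↑) : ℤ → ℚ) := by
  have : Algebra.IsAlgebraic F Fbar := IsAlgClosure.isAlgebraic
  exact valBar_algebraMap O x

lemma slopes_eq (T : V →ₗ[F] V) : slopes O Fbar T =
    (T.charpoly.map (algebraMap F Fbar)).roots.map (valAlgClosure O F Fbar) := rfl

lemma sum_slopes (T : V →ₗ[F] V) :
    (slopes O Fbar T).sum = valBase O F Fbar (LinearMap.det T) := by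
  have : IsAlgClosed Fbar := IsAlgClosure.isAlgClosed F
  have hc : (T.charpoly.map (algebraMap F Fbar)) =
      ((LinearMap.toMatrix (finBasis F V) (finBasis F V) T).map (algebraMap F Fbar)).charpoly := by
    rw [← LinearMap.charpoly_toMatrix T (finBasis F V), Matrix.charpoly_map]
  rw [slopes_eq, ← map_multiset_prod, hc, ← Matrix.det_eq_prod_roots_charpoly,
    ← RingHom.mapMatrix_apply, ← RingHom.map_det, LinearMap.det_toMatrix]
  rfl

lemma card_slopes (T : V →ₗ[F] V) : (slopes O Fbar T).card = finrank F V := by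
  rw [← length_sort_slopes O Fbar T, Multiset.length_sort]

lemma partialSum_newtonPoint (T : V →ₗ[F] V) (k : ℕ) :
    partialSum (newtonPoint O Fbar T) k = (((slopes O Fbar T).sort (· ≤ ·)).take k).sum := by
  have h : List.ofFn (newtonPoint O Fbar T) = (slopes O Fbar T).sort (· ≤ ·) := by
    refine List.ext_getElem (by rw [List.length_ofFn, length_sort_slopes]) fun i h1 h2 => ?_
    simp [newtonPoint]
  rw [← h, List.sum_take_ofFn]
  rfl

lemma partialSum_newtonPoint_finrank (T : V →ₗ[F] V) :
    partialSum (newtonPoint O Fbar T) (finrank F V) = valBase O F Fbar (LinearMap.det T) := by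
  rw [partialSum_newtonPoint, List.take_of_length_le (length_sort_slopes O Fbar T).le,
    ← Multiset.sum_coe, Multiset.sort_eq, sum_slopes]

lemma slopes_eq_add_of_isCompl (T : V →ₗ[F] V) {U W : Submodule F V} (hU : ∀ x ∈ U, T x ∈ U)
    (hW : ∀ x ∈ W, T x ∈ W) (hUW : IsCompl U W) :
    slopes O Fbar T = slopes O Fbar (T.restrict hU) + slopes O Fbar (T.restrict hW) := by
  have hc : T.charpoly = (T.restrict hU).charpoly * (T.restrict hW).charpoly := by
    rw [← LinearMap.charpoly_prodMap, ← LinearEquiv.charpoly_conj (U.prodEquivOfIsCompl W hUW)]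
    congr 1
    ext x
    obtain ⟨⟨u, w⟩, rfl⟩ := (U.prodEquivOfIsCompl W hUW).surjective x
    rw [LinearEquiv.conj_apply_apply, LinearEquiv.symm_apply_apply]
    simp
  rw [slopes_eq, slopes_eq, slopes_eq, hc, Polynomial.map_mul, Polynomial.roots_mul,
    Multiset.map_add]
  exact (((LinearMap.charpoly_monic _).map _).mul ((LinearMap.charpoly_monic _).map _)).ne_zero

/-- If the slopes on `U` precede those on the complement `W`, then the first `dim U` entries of the
Newton point are the slopes on `U`. -/
lemma partialSum_newtonPoint_of_isCompl (T : V →ₗ[F] V) {U W : Submodule F V}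
    (hU : ∀ x ∈ U, T x ∈ U) (hW : ∀ x ∈ W, T x ∈ W) (hUW : IsCompl U W)
    (h : ∀ a ∈ slopes O Fbar (T.restrict hU), ∀ b ∈ slopes O Fbar (T.restrict hW), a < b) :
    partialSum (newtonPoint O Fbar T) (finrank F U) =
      valBase O F Fbar (LinearMap.det (T.restrict hU)) := by
  rw [partialSum_newtonPoint, slopes_eq_add_of_isCompl O Fbar T hU hW hUW,
    sort_add_of_forall_lt h, List.take_left' (length_sort_slopes O Fbar _), ← Multiset.sum_coe,
    Multiset.sort_eq, sum_slopes]

/-- The sum of the `k` smallest slopes is the valuation of the determinant on a stable subspace of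
dimension `k` over the algebraic closure. -/
lemma exists_stable_partialSum_newtonPoint {n : ℕ} (e : Basis (Fin n) F V) (T : V →ₗ[F] V) {k : ℕ}
    (hk : k ≤ finrank F V) :
    ∃ (X : Submodule Fbar (Fin n → Fbar))
      (hX : ∀ x ∈ X, ((LinearMap.toMatrix e e T).map (algebraMap F Fbar)).toLin' x ∈ X),
      finrank Fbar X = k ∧ valAlgClosure O F Fbar (LinearMap.det (LinearMap.restrict _ hX)) =
        partialSum (newtonPoint O Fbar T) k := by
  have : IsAlgClosed Fbar := IsAlgClosure.isAlgClosed F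
  have hc : (((LinearMap.toMatrix e e T).map (algebraMap F Fbar)).toLin').charpoly =
      T.charpoly.map (algebraMap F Fbar) := by
    rw [Matrix.charpoly_toLin', Matrix.charpoly_map, LinearMap.charpoly_toMatrix]
  have hle : (((slopes O Fbar T).sort (· ≤ ·)).take k : Multiset (WithTop ℚ)) ≤
      (T.charpoly.map (algebraMap F Fbar)).roots.map (valAlgClosure O F Fbar) := by
    rw [← slopes_eq]
    conv_rhs => rw [← Multiset.sort_eq (slopes O Fbar T) (· ≤ ·)]
    exact (List.take_sublist _ _).subperm
  obtain ⟨s, hs, hsk⟩ := exists_le_map_eq _ hle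
  obtain ⟨X, hX, hXc⟩ := exists_stable_of_le_roots
    ((LinearMap.toMatrix e e T).map (algebraMap F Fbar)).toLin' s (hc ▸ hs)
  have hcard : s.card = k := by
    rw [← Multiset.card_map (valAlgClosure O F Fbar), hsk, Multiset.coe_card, List.length_take,
      length_sort_slopes, min_eq_left hk]
  refine ⟨X, hX, ?_, ?_⟩
  · rw [← LinearMap.charpoly_natDegree (LinearMap.restrict _ hX), hXc,
      Polynomial.natDegree_multiset_prod_X_sub_C_eq_card, hcard]
  · rw [Module.End.det_eq_prod_roots_charpoly_of_splits (IsAlgClosed.splits _), hXc,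
      Polynomial.roots_multiset_prod_X_sub_C, map_multiset_prod, hsk, partialSum_newtonPoint,
      Multiset.sum_coe]

end Slopes

/-! ### Integral vectors of a lattice -/

section Lattices

variable {O : Type*} [CommRing O] [IsDomain O] [IsDiscreteValuationRing O]
  [IsAdicComplete (IsLocalRing.maximalIdeal O) O]
  {F : Type*} [Field F] [Algebra O F] [IsFractionRing O F]
  (Fbar : Type*) [Field Fbar] [Algebra F Fbar] [IsAlgClosure F Fbar]
  {V : Type*} [AddCommGroup V] [Module F V] [Module O V] [IsScalarTower O F V]

lemma valBase_nonneg_iff (x : F) : 0 ≤ valBase O F Fbar x ↔ ∃ a : O, algebraMap O F a = x := by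
  have hle : 0 ≤ valBase O F Fbar x ↔
      (IsDiscreteValuationRing.maximalIdeal O).valuation F x ≤ 1 := by
    rw [valBase_apply, val]
    split_ifs with h
    · simp [h]
    · have hv : (IsDiscreteValuationRing.maximalIdeal O).valuation F x ≠ 0 := by simpa using h
      rw [WithTop.map_coe, ← WithTop.coe_zero, WithTop.coe_le_coe, Int.cast_nonneg_iff, neg_nonneg,
        WithZero.log_le_iff_le_exp hv, WithZero.exp_zero]
  rw [hle]
  exact ⟨fun h => IsDiscreteValuationRing.exists_lift_of_le_one h, by
    rintro ⟨a, rfl⟩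
    exact IsDedekindDomain.HeightOneSpectrum.valuation_le_one _ a⟩

lemma valBase_uniformizer {ϖ : O} (hϖ : Irreducible ϖ) :
    valBase O F Fbar (algebraMap O F ϖ) = 1 := by
  have h0 : algebraMap O F ϖ ≠ 0 := by simpa using hϖ.ne_zero
  have hv : (IsDiscreteValuationRing.maximalIdeal O).valuation F (algebraMap O F ϖ) =
      WithZero.exp (-1 : ℤ) := by
    rw [IsDedekindDomain.HeightOneSpectrum.valuation_of_algebraMap]
    exact IsDedekindDomain.HeightOneSpectrum.intValuation_singleton _ hϖ.ne_zero
      hϖ.maximalIdeal_eq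
  rw [valBase_apply, val, if_neg h0, hv]
  simp

lemma valBase_extPow {ϖ : O} (hϖ : Irreducible ϖ) (m : WithTop ℤ) :
    valBase O F Fbar (extPow F ϖ m) = m.map ((↑) : ℤ → ℚ) := by
  induction m using WithTop.recTopCoe with
  | top => exact AddValuation.map_zero _
  | coe m =>
    have h0 : algebraMap O F ϖ ≠ 0 := by simpa using hϖ.ne_zero
    have hnat : ∀ k : ℕ, valBase O F Fbar (algebraMap O F ϖ ^ k) = ((k : ℚ) : WithTop ℚ) :=
      fun k => by
        rw [AddValuation.map_pow, valBase_uniformizer Fbar hϖ, nsmul_one]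
        rfl
    change valBase O F Fbar (algebraMap O F ϖ ^ m) = ((m : ℚ) : WithTop ℚ)
    obtain ⟨k, rfl | rfl⟩ := m.eq_nat_or_neg
    · simpa using hnat k
    · have h1 : valBase O F Fbar (algebraMap O F ϖ ^ (-(k : ℤ))) + ((k : ℚ) : WithTop ℚ) = 0 := by
        rw [← hnat, ← AddValuation.map_mul, zpow_neg, zpow_natCast,
          inv_mul_cancel₀ (pow_ne_zero _ h0), AddValuation.map_one]
      have h2 : ((((-(k : ℤ) : ℤ) : ℚ)) : WithTop ℚ) + ((k : ℚ) : WithTop ℚ) = 0 := by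
        rw [← WithTop.coe_add]
        simp
      exact (WithTop.add_right_inj WithTop.coe_ne_top).mp (h1.trans h2.symm)

variable {Λ : Submodule O V} [Submodule.IsLattice F Λ] {n : ℕ} (b : Basis (Fin n) O Λ)

lemma isIntegralVec_iff_mem (z : V) :
    IsIntegralVec (valBase O F Fbar) (b.extendOfIsLattice F) z ↔ z ∈ Λ := by
  constructor
  · intro hz
    rw [← (b.extendOfIsLattice F).sum_repr z]
    refine Λ.sum_mem fun i _ => ?_
    obtain ⟨a, ha⟩ := (valBase_nonneg_iff Fbar _).mp (hz i)
    rw [← ha, Module.Basis.extendOfIsLattice_apply, algebraMap_smul]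
    exact Λ.smul_mem a (b i).2
  · intro hz i
    have h : z = ∑ j, algebraMap O F (b.repr ⟨z, hz⟩ j) • b.extendOfIsLattice F j := by
      have := congrArg Λ.subtype (b.sum_repr ⟨z, hz⟩)
      rw [map_sum] at this
      simp only [Module.Basis.extendOfIsLattice_apply, algebraMap_smul]
      exact this.symm
    have hi : (b.extendOfIsLattice F).repr z i = algebraMap O F (b.repr ⟨z, hz⟩ i) := by
      conv_lhs => rw [h]
      rw [Module.Basis.repr_sum_self]
    rw [hi, valBase_nonneg_iff]
    exact ⟨_, rfl⟩

end Lattices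

/-! ### The Hodge point as a bound on matrix entries -/

section HodgePoint

variable {O : Type*} [CommRing O] [IsDomain O] [IsDiscreteValuationRing O]
  [IsAdicComplete (IsLocalRing.maximalIdeal O) O]
  {F : Type*} [Field F] [Algebra O F] [IsFractionRing O F]
  (Fbar : Type*) [Field Fbar] [Algebra F Fbar] [IsAlgClosure F Fbar]
  {V : Type*} [AddCommGroup V] [Module F V] [Module O V] [IsScalarTower O F V]
  {Λ : Submodule O V} [Submodule.IsLattice F Λ] {n : ℕ} (b : Basis (Fin n) O Λ)
  {ϖ : O} {T : V →ₗ[F] V} {μ : Fin n → WithTop ℤ}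

lemma monotone_toRat (hμ : Monotone μ) : Monotone (toRat μ) := fun _ _ hij =>
  (Int.cast_mono (R := ℚ)).withTop_map (hμ hij)

/-- In the basis of `Λ` adapted to the Hodge point, the `i`-th row of the matrix of `T` is divisible
by `ϖ ^ μᵢ`. -/
lemma toRat_le_valBase_repr (hϖ : Irreducible ϖ)
    (hb : Λ.map (T.restrictScalars O) =
      Submodule.span O (Set.range fun i => extPow F ϖ (μ i) • (b i : V))) (i j : Fin n) :
    toRat μ i ≤ valBase O F Fbar
      ((b.extendOfIsLattice F).repr (T (b.extendOfIsLattice F j)) i) := by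
  have hmem : T (b.extendOfIsLattice F j) ∈
      Submodule.span O (Set.range fun i => extPow F ϖ (μ i) • (b i : V)) := by
    rw [← hb, Module.Basis.extendOfIsLattice_apply]
    exact ⟨b j, (b j).2, rfl⟩
  obtain ⟨c, hc⟩ := (Submodule.mem_span_range_iff_exists_fun O).mp hmem
  have h : T (b.extendOfIsLattice F j) =
      ∑ i, (algebraMap O F (c i) * extPow F ϖ (μ i)) • b.extendOfIsLattice F i := by
    rw [← hc]
    refine Finset.sum_congr rfl fun i _ => ?_
    rw [Module.Basis.extendOfIsLattice_apply, mul_smul, algebraMap_smul]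
  rw [h, Module.Basis.repr_sum_self, AddValuation.map_mul, valBase_extPow Fbar hϖ]
  exact le_add_of_nonneg_left ((valBase_nonneg_iff Fbar _).mpr ⟨_, rfl⟩)

/-- The generators `ϖ ^ μᵢ • bᵢ` are images under `T` of lattice vectors, so the diagonal matrix of
the `ϖ ^ μᵢ` is the matrix of `T` times an integral matrix. -/
lemma valBase_det_le (hϖ : Irreducible ϖ)
    (hb : Λ.map (T.restrictScalars O) =
      Submodule.span O (Set.range fun i => extPow F ϖ (μ i) • (b i : V))) :
    valBase O F Fbar (LinearMap.det T) ≤ ∑ i, toRat μ i := by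
  have hmem : ∀ i, ∃ z ∈ Λ, T z = extPow F ϖ (μ i) • (b i : V) := fun i => by
    have : extPow F ϖ (μ i) • (b i : V) ∈ Λ.map (T.restrictScalars O) := by
      rw [hb]
      exact Submodule.subset_span ⟨i, rfl⟩
    exact this
  choose z hz hTz using hmem
  set B := b.extendOfIsLattice F with hB
  have hT : B.det (fun i => T (z i)) = LinearMap.det T * B.det z := by
    have := B.det_comp T z
    rwa [Function.comp_def] at this
  have hD : B.det (fun i => T (z i)) = ∏ i, extPow F ϖ (μ i) := by
    have h : (fun i => T (z i)) = fun i => extPow F ϖ (μ i) • B i := by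
      funext i
      rw [hTz, hB, Module.Basis.extendOfIsLattice_apply]
    rw [h, AlternatingMap.map_smul_univ, Module.Basis.det_self, smul_eq_mul, mul_one]
  have hz0 : 0 ≤ valBase O F Fbar (B.det z) := by
    have h : B.det z = coordDet B id z := by
      rw [coordDet_apply, Module.Basis.det_apply, ← Matrix.det_transpose]
      rfl
    rw [h]
    exact coordDet_nonneg id z fun i => (isIntegralVec_iff_mem Fbar b (z i)).mpr (hz i)
  have hv := congrArg (valBase O F Fbar) (hD.symm.trans hT)
  rw [map_prod_eq_sum, AddValuation.map_mul] at hv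
  simp only [valBase_extPow Fbar hϖ] at hv
  change ∑ i, toRat μ i = _ at hv
  rw [hv]
  exact le_add_of_nonneg_right hz0

end HodgePoint

/-! ### The dominance inequality and the decomposition of the lattice -/

section Main

variable {O : Type*} [CommRing O] [IsDomain O] [IsDiscreteValuationRing O]
  [IsAdicComplete (IsLocalRing.maximalIdeal O) O]
  {F : Type*} [Field F] [Algebra O F] [IsFractionRing O F]
  (Fbar : Type*) [Field Fbar] [Algebra F Fbar] [IsAlgClosure F Fbar]
  {V : Type*} [AddCommGroup V] [Module F V] [Module O V] [IsScalarTower O F V]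
  [FiniteDimensional F V] {ϖ : O} {T : V →ₗ[F] V} {Λ : Submodule O V} [Submodule.IsLattice F Λ]
  {μ : Fin (finrank F V) → WithTop ℤ}

/-- Mazur's inequality. The inequalities come from stable subspaces over the algebraic closure, the
equality of the total sums from comparing determinants. -/
theorem IsHodgePoint.dominanceLE (hϖ : Irreducible ϖ) (h : IsHodgePoint ϖ T Λ μ) :
    DominanceLE (newtonPoint O Fbar T) (toRat μ) := by
  obtain ⟨hmono, b, hb⟩ := h
  have hμ := monotone_toRat hmono
  have hle := toRat_le_valBase_repr Fbar b hϖ hb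
  refine ⟨fun k _ hk => ?_, ?_⟩
  · obtain ⟨X, hX, hXk, hXv⟩ :=
      exists_stable_partialSum_newtonPoint O Fbar (b.extendOfIsLattice F) T hk.le
    rw [← hXv, ← hXk]
    refine partialSum_le_map_det_restrict (e := Pi.basisFun Fbar _) hμ (fun i j => ?_) hX
    refine (hle i j).trans_eq ?_
    rw [Pi.basisFun_apply, Matrix.toLin'_apply, Matrix.mulVec_single_one, Pi.basisFun_repr]
    simp only [Matrix.col_apply, Matrix.map_apply, LinearMap.toMatrix_apply]
    rfl
  · have htotal : partialSum (toRat μ) (finrank F V) = ∑ i, toRat μ i := by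
      simp [partialSum]
    rw [partialSum_newtonPoint_finrank]
    refine le_antisymm ?_ (htotal ▸ valBase_det_le Fbar b hϖ hb)
    have := partialSum_le_map_det_restrict hμ hle (X := ⊤) fun _ _ => trivial
    rw [finrank_top] at this
    refine this.trans_eq (congrArg _ ?_)
    exact LinearMap.det_conj T Submodule.topEquiv.symm

/-- The Hodge–Newton decomposition of a lattice: it suffices that the projection onto `U` along `W`
maps `Λ` to itself, which is `isIntegralVec_of_add`. -/
theorem IsHodgePoint.eq_sup_of_partialSum_eq (hϖ : Irreducible ϖ) (h : IsHodgePoint ϖ T Λ μ)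
    {U W : Submodule F V} (hU : ∀ x ∈ U, T x ∈ U) (hW : ∀ x ∈ W, T x ∈ W) (hUW : IsCompl U W)
    (hlt : ∀ a ∈ slopes O Fbar (T.restrict hU), ∀ b ∈ slopes O Fbar (T.restrict hW), a < b)
    (hr : partialSum (toRat μ) (finrank F U) = partialSum (newtonPoint O Fbar T) (finrank F U)) :
    Λ = (Λ ⊓ U.restrictScalars O) ⊔ (Λ ⊓ W.restrictScalars O) := by
  have : IsAlgClosed Fbar := IsAlgClosure.isAlgClosed F
  obtain ⟨hmono, b, hb⟩ := h
  suffices hproj : ∀ (u : U) (y : W), (u : V) + y ∈ Λ → (u : V) ∈ Λ by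
    refine le_antisymm (fun z hz => ?_) (sup_le inf_le_left inf_le_left)
    have hz' : z ∈ U ⊔ W := hUW.sup_eq_top ▸ trivial
    obtain ⟨u, hu, y, hy, rfl⟩ := Submodule.mem_sup.mp hz'
    have huΛ := hproj ⟨u, hu⟩ ⟨y, hy⟩ hz
    refine Submodule.add_mem_sup ⟨huΛ, hu⟩ ⟨?_, hy⟩
    simpa using Λ.sub_mem hz huΛ
  intro u y huy
  by_cases hW0 : slopes O Fbar (T.restrict hW) = 0
  · have hbot : W = ⊥ := by
      rw [← Submodule.finrank_eq_zero (R := F), ← card_slopes O Fbar (T.restrict hW), hW0,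
        Multiset.card_zero]
    have hy0 : (y : V) = 0 := (Submodule.mem_bot F).mp (hbot ▸ y.2)
    rwa [hy0, add_zero] at huy
  obtain ⟨q, hq⟩ := Multiset.exists_mem_of_ne_zero hW0
  obtain ⟨α, β, hαβ, hα, hβ⟩ := exists_coe_lt_of_forall_lt
    (fun x hx => ((hlt x hx q hq).trans_le le_top).ne) hlt
  have hα' : ∀ a ∈ ((T.restrict hU).charpoly.map (algebraMap F Fbar)).roots,
      valAlgClosure O F Fbar a ≤ (α : WithTop ℚ) := fun a ha =>
    hα _ (Multiset.mem_map_of_mem _ ha)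
  have hβ' : ∀ a ∈ ((T.restrict hW).charpoly.map (algebraMap F Fbar)).roots,
      (β : WithTop ℚ) ≤ valAlgClosure O F Fbar a := fun a ha =>
    hβ _ (Multiset.mem_map_of_mem _ ha)
  have hdet : LinearMap.det (T.restrict hU) ≠ 0 := by
    rw [← (valBase O F Fbar).ne_top_iff, ← sum_slopes]
    intro htop
    have hsum := Multiset.sum_le_card_nsmul _ _ hα
    rw [htop, top_le_iff, ← WithTop.coe_nsmul] at hsum
    exact WithTop.coe_ne_top hsum
  let R : U →ₗ[F] U := ((T.restrict hU).equivOfDetNeZero hdet).symm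
  have hTR : T.restrict hU * R = 1 :=
    LinearMap.ext ((T.restrict hU).equivOfDetNeZero hdet).apply_symm_apply
  rw [partialSum_newtonPoint_of_isCompl O Fbar T hU hW hUW hlt] at hr
  rw [← isIntegralVec_iff_mem Fbar b] at huy ⊢
  exact isIntegralVec_of_add (monotone_toRat hmono) (toRat_le_valBase_repr Fbar b hϖ hb) hU hW
    hr.ge hTR hαβ
    (exists_linear_le_map_pow_inverse _ hTR (mul_eq_one_comm.mp hTR) α hα')
    (exists_linear_le_map_pow _ _ β hβ') u y huy

end Main

end HodgeNewton

theorem mainTheorem3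
    {O : Type*} [CommRing O] [IsDomain O] [IsDiscreteValuationRing O]
    [IsAdicComplete (IsLocalRing.maximalIdeal O) O]
    {F : Type*} [Field F] [Algebra O F] [IsFractionRing O F]
    (Fbar : Type*) [Field Fbar] [Algebra F Fbar] [IsAlgClosure F Fbar]
    {ϖ : O} (hϖ : Irreducible ϖ)
    {V : Type*} [AddCommGroup V] [Module F V] [Module O V] [IsScalarTower O F V]
    [FiniteDimensional F V]
    (T : V →ₗ[F] V) (Λ : Submodule O V) [Submodule.IsLattice F Λ] :
    HodgeNewton.DominanceLE (HodgeNewton.newtonPoint O Fbar T)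
      (HodgeNewton.toRat (HodgeNewton.hodgePoint hϖ T Λ)) ∧
    ∀ (U W : Submodule F V) (hU : ∀ x ∈ U, T x ∈ U) (hW : ∀ x ∈ W, T x ∈ W),
      IsCompl U W →
      (∀ a ∈ HodgeNewton.slopes O Fbar (T.restrict hU),
        ∀ b ∈ HodgeNewton.slopes O Fbar (T.restrict hW), a < b) →
      HodgeNewton.partialSum (HodgeNewton.toRat (HodgeNewton.hodgePoint hϖ T Λ))
          (Module.finrank F U) =
        HodgeNewton.partialSum (HodgeNewton.newtonPoint O Fbar T) (Module.finrank F U) →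
      Λ = (Λ ⊓ U.restrictScalars O) ⊔ (Λ ⊓ W.restrictScalars O) ∧
        Disjoint (Λ ⊓ U.restrictScalars O) (Λ ⊓ W.restrictScalars O) := by
  have h := HodgeNewton.isHodgePoint_hodgePoint hϖ T Λ
  refine ⟨h.dominanceLE Fbar hϖ, fun U W hU hW hUW hlt hr =>
    ⟨h.eq_sup_of_partialSum_eq Fbar hϖ hU hW hUW hlt hr, ?_⟩⟩
  rw [Submodule.disjoint_def]
  exact fun z hzU hzW => Submodule.disjoint_def.mp hUW.disjoint z hzU.2 hzW.2
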